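/- Graphs are finite multigraphs, given by a finite vertex set and a finite multiset of unordered pairs of vertices. The independence polynomial of a graph $G$ is $Z_G(\lambda)=\sum_I \lambda^{\#I}$, summed over all independent sets $I\subseteq V(G)$ (no edge has all its endpoints in $I$). Let $k\ge 2$. A marked graph is a graph with $k$ distinct marked vertices labeled $1,\dots,k$. **Gluing data.** A gluing data $(H,\Sigma,\Upsilon,\Phi)$ with parameters $m,k\ge 2$ consists of: a multi-hypergraph $H$ on $V(H)=\{w_1,\dots,w_m\}$ with a finite multiset $E(H)$ of non-empty edges, each edge $e$ having a label $\ell(e)\in\{1,\dots,k\}$, such that for each $j$ the edges labeled $j$ partition $V(H)$; non-empty connected graphs $\Sigma_e$ with a root $v_e\in V(\Sigma_e)$, for $e\in E(H)$; maps $\Upsilon_e:e\to V(\Sigma_e)$, for $e\in E(H)$; and an injective map $\Phi:\{1,\dots,k\}\to E(H)$. **Recursion.** For a marked graph $G$, the marked graph $\mathcal R(G)$ is obtained from the disjoint union of $m$ copies $G(1),\dots,G(m)$ of $G$ and of all $\Sigma_e$ by identifying, for each $e\in E(H)$ and $w_i\in e$, the marked vertex of $G(i)$ labeled $\ell(e)$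 with $\Upsilon_e(w_i)$; the new label $j$ is given to the root of $\Sigma_{\Phi(j)}$. For $n\ge1$ the iterate $\mathcal R^n$ is again the recursion of a gluing data $(H_n,\Sigma_n,\Upsilon_n,\Phi_n)$, where $(H_1,\Sigma_1,\Upsilon_1,\Phi_1)=(H,\Sigma,\Upsilon,\Phi)$ and $(H_{n+1},\Sigma_{n+1},\Upsilon_{n+1},\Phi_{n+1})$ is the gluing data of $\mathcal R\circ\mathcal R^n$: $V(H_{n+1})=V(H)\times V(H_n)$; each $e\in E(H)$ with label $j$ yields an edge $e\times\Phi_n(j)$, with the label of $\Phi_n(j)$ and with connecting graph $\Sigma_e$ to which, for each $w\in e$, a copy of $\Sigma_{n,\Phi_n(j)}$ is glued by identifying its root with $\Upsilon_e(w)$; each $w\in V(H)$ and each $f\in E(H_n)$ outside the image of $\Phi_n$ yield an edge $\{w\}\times f$, with the label, connecting graph and attaching map of $f$; and $\Phi_{n+1}(j)$ is the edge arising from $\Phi(j)$. **Conditions.** Let $\Lambda(j)=\ell(\Phi(j))$; a label $j$ is periodic if $\Lambda^p(j)=j$ for some $p\ge1$. The gluing data is *stable* if for each periodic label $j$ one has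 $\#\Phi(j)=1$ and $\Sigma_{\Phi(j)}$ is the one-vertex graph $K_1$. It is *expanding* if for some $n\ge1$ the edges $\Phi_n(j)$ and $\Phi_n(l)$ are disjoint subsets of $V(H_n)$ for all $j\ne l$. A marked graph $G$ is *maximally independent* if for every $x\in\{0,1\}^k$ there is a unique independent set $I(x)$ of maximal cardinality among the independent sets that, for each $j$, contain the marked vertex labeled $j$ if and only if $x_j=1$, and moreover $\#I(1,\dots,1)-\#I(0,\dots,0)=k$. **Statement.** Suppose that the gluing data $(H,\Sigma,\Upsilon,\Phi)$ is stable and expanding and that $G_0$ is a maximally independent marked graph. Let $G_{n+1}=\mathcal R(G_n)$ for $n\ge0$. Then the zeros of the independence polynomials $Z_{G_n}(\lambda)$ are uniformly bounded: there is a constant $C$ such that for all $n\ge0$ and $\lambda\in\mathbb C$, $Z_{G_n}(\lambda)=0$ implies $|\lambda|\le C$. -/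

import Mathlib

/-- A finite multigraph: a finite vertex type and a finite multiset of unordered pairs of vertices.
Loops `s(v, v)` are permitted. -/
structure Multigraph where
  V : Type
  [fintypeV : Fintype V]
  edges : Multiset (Sym2 V)

attribute [instance] Multigraph.fintypeV

namespace Multigraph

/-- No edge of `G` has all its endpoints in `I`. -/
def IsIndep (G : Multigraph) (I : Finset G.V) : Prop :=
  ∀ e ∈ G.edges, ¬ ∀ v ∈ e, v ∈ I

def Adj (G : Multigraph) (u v : G.V) : Prop :=
  s(u, v) ∈ G.edges

/-- `G` is non-empty and any two vertices are joined by a walk. -/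
def IsConnected (G : Multigraph) : Prop :=
  Nonempty G.V ∧ ∀ u v : G.V, Relation.ReflTransGen G.Adj u v

/-- `G` is the graph `K₁`. -/
def IsSingleton (G : Multigraph) : Prop :=
  Fintype.card G.V = 1 ∧ G.edges = 0

open Classical in
/-- The independence polynomial; a vertex assignment `σ : V → {0, 1}` is encoded by `σ⁻¹(1)`. -/
noncomputable def indepPoly (G : Multigraph) : Polynomial ℂ :=
  ∑ I ∈ (Finset.univ : Finset (Finset G.V)).filter G.IsIndep, Polynomial.X ^ I.card

end Multigraph

/-- A multigraph with `k` distinct marked vertices, labeled by `Fin k`. -/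
structure MarkedGraph (k : ℕ) extends Multigraph where
  mark : Fin k → V
  mark_injective : Function.Injective mark

namespace MarkedGraph

variable {k : ℕ}

/-- `I` contains the marked vertex labeled `j` if and only if `x j = 1`. -/
def Agrees (G : MarkedGraph k) (x : Fin k → Bool) (I : Finset G.V) : Prop :=
  ∀ j, G.mark j ∈ I ↔ x j = true

/-- `I` has maximal cardinality among the independent sets of `G` that agree with `x`. -/
def IsMaxAgreeing (G : MarkedGraph k) (x : Fin k → Bool) (I : Finset G.V) : Prop :=
  G.IsIndep I ∧ G.Agrees x I ∧ ∀ J : Finset G.V, G.IsIndep J → G.Agrees x J → J.card ≤ I.card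

def IsMaximallyIndependent (G : MarkedGraph k) : Prop :=
  ∃ I : (Fin k → Bool) → Finset G.V,
    (∀ x, G.IsMaxAgreeing x (I x) ∧ ∀ J, G.IsMaxAgreeing x J → J = I x) ∧
    (((I fun _ => true).card : ℤ) - ((I fun _ => false).card : ℤ) = k)

end MarkedGraph

/-- Gluing data `(H, Σ, Υ, Φ)` with `k` labels. The multi-hypergraph `H` has vertex set `W` (so the
parameter `m` is the cardinality of `W`) and its edge multiset is indexed by `E`. -/
structure GluingData (k : ℕ) where
  W : Type
  [fintypeW : Fintype W]
  E : Type
  [fintypeE : Fintype E]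
  /-- the vertices of an edge of `H` -/
  verts : E → Finset W
  verts_nonempty : ∀ e, (verts e).Nonempty
  label : E → Fin k
  /-- the edges labeled `j` partition `W` -/
  existsUnique_edge : ∀ (w : W) (j : Fin k), ∃! e, w ∈ verts e ∧ label e = j
  /-- the connecting graphs `Σ_e` -/
  conn : E → Multigraph
  conn_connected : ∀ e, (conn e).IsConnected
  /-- the roots of the connecting graphs -/
  root : ∀ e, (conn e).V
  /-- the attaching maps `Υ_e : e → V(Σ_e)` -/
  attach : ∀ e, {w // w ∈ verts e} → (conn e).V
  /-- the labeling map `Φ` -/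
  Phi : Fin k → E
  Phi_injective : Function.Injective Phi

attribute [instance] GluingData.fintypeW GluingData.fintypeE

namespace GluingData

variable {k : ℕ}

section Recursion

variable (D : GluingData k)

/-- The edge of `H` labeled `j` that contains `w`. -/
noncomputable def edgeAt (w : D.W) (j : Fin k) : D.E :=
  (D.existsUnique_edge w j).choose

theorem mem_verts_edgeAt (w : D.W) (j : Fin k) : w ∈ D.verts (D.edgeAt w j) :=
  (D.existsUnique_edge w j).choose_spec.1.1

/-- The vertex set of `R(G)`. Every marked vertex of every copy of `G` is identified with exactly one
vertex of exactly one connecting graph, so the disjoint union of the copies `G(w)` and the graphs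
`Σ_e` becomes, after the identifications, the disjoint union of the unmarked vertices of the copies
and all vertices of the `Σ_e`. -/
abbrev RecVertex (G : MarkedGraph k) : Type :=
  (D.W × {v : G.V // ¬ ∃ j, G.mark j = v}) ⊕ (Σ e : D.E, (D.conn e).V)

open Classical in
/-- The map from the copy `G(w)` to `R(G)`: the marked vertex labeled `j` goes to `Υ_e(w)`, where `e`
is the edge labeled `j` that contains `w`. -/
noncomputable def copyMap (G : MarkedGraph k) (w : D.W) (v : G.V) : D.RecVertex G :=
  if h : ∃ j, G.mark j = v then
    Sum.inr ⟨D.edgeAt w h.choose, D.attach _ ⟨w, D.mem_verts_edgeAt w h.choose⟩⟩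
  else Sum.inl (w, ⟨v, h⟩)

/-- The identifications made in `R(G)`. -/
theorem copyMap_mark (G : MarkedGraph k) (e : D.E) (w : D.W) (hw : w ∈ D.verts e) :
    D.copyMap G w (G.mark (D.label e)) = Sum.inr ⟨e, D.attach e ⟨w, hw⟩⟩ := by
  have h : ∃ j, G.mark j = G.mark (D.label e) := ⟨_, rfl⟩
  have hj : h.choose = D.label e := G.mark_injective h.choose_spec
  have he : e = D.edgeAt w h.choose :=
    (D.existsUnique_edge w h.choose).choose_spec.2 e ⟨hw, hj.symm⟩
  unfold copyMap
  rw [dif_pos h]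
  generalize_proofs p
  revert p
  rw [← he]
  intro p
  rfl

open Classical in
/-- The graph recursion `R`: the edges of `R(G)` are the edges of all copies of `G` together with the
edges of all connecting graphs, and the new label `j` is put on the root of `Σ_{Φ(j)}`. -/
noncomputable def recursion (G : MarkedGraph k) : MarkedGraph k where
  V := D.RecVertex G
  edges := (∑ w : D.W, G.edges.map (Sym2.map (D.copyMap G w))) +
    ∑ e : D.E, (D.conn e).edges.map (Sym2.map fun v => (Sum.inr ⟨e, v⟩ : D.RecVertex G))
  mark j := Sum.inr ⟨D.Phi j, D.root (D.Phi j)⟩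
  mark_injective := fun _ _ h =>
    D.Phi_injective (congrArg Sigma.fst (Sum.inr_injective h))

/-- `G_0 = G`, `G_{n+1} = R(G_n)`. -/
noncomputable def graphSeq (G : MarkedGraph k) : ℕ → MarkedGraph k
  | 0 => G
  | n + 1 => D.recursion (graphSeq G n)

end Recursion

section Composition

variable (A B : GluingData k)

/-- The vertices of the connecting graph of the composition `R_A ∘ R_B` that arises from an edge `e`
of `A`: for every `w ∈ e` a copy of the connecting graph `Σ` of `B` whose root carries the label of
`e` is glued to `Σ_e`, by identifying the root of the copy with `Υ_e(w)`. -/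
abbrev CompVertex (e : A.E) : Type :=
  (A.conn e).V ⊕
    ({w // w ∈ A.verts e} × {v // v ≠ B.root (B.Phi (A.label e))})

open Classical in
/-- The map to that connecting graph from the copy indexed by `w ∈ e`. -/
noncomputable def compMap (e : A.E) (w : {w // w ∈ A.verts e})
    (v : (B.conn (B.Phi (A.label e))).V) : CompVertex A B e :=
  if h : v = B.root (B.Phi (A.label e)) then Sum.inl (A.attach e w) else Sum.inr (w, ⟨v, h⟩)

open Classical in
/-- The connecting graph of `R_A ∘ R_B` that arises from an edge `e` of `A`. -/
noncomputable def compConn (e : A.E) : Multigraph where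
  V := CompVertex A B e
  edges := (A.conn e).edges.map (Sym2.map Sum.inl) +
    ∑ w : {w // w ∈ A.verts e},
      (B.conn (B.Phi (A.label e))).edges.map (Sym2.map (compMap A B e w))

theorem compConn_connected (e : A.E) : (compConn A B e).IsConnected := by
  classical
  have hA : ∀ u v : (A.conn e).V,
      Relation.ReflTransGen (compConn A B e).Adj (Sum.inl u) (Sum.inl v) := by
    intro u v
    refine Relation.ReflTransGen.lift (r := (A.conn e).Adj) (p := (compConn A B e).Adj)
      Sum.inl ?_ _ _ ((A.conn_connected e).2 u v)
    intro a b hab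
    exact Multiset.mem_add.2 (Or.inl (Multiset.mem_map.2 ⟨s(a, b), hab, rfl⟩))
  have hB : ∀ (w : {w // w ∈ A.verts e}) (u v : (B.conn (B.Phi (A.label e))).V),
      Relation.ReflTransGen (compConn A B e).Adj (compMap A B e w u) (compMap A B e w v) := by
    intro w u v
    refine Relation.ReflTransGen.lift (r := (B.conn (B.Phi (A.label e))).Adj)
      (p := (compConn A B e).Adj) (compMap A B e w) ?_ _ _ ((B.conn_connected _).2 u v)
    intro a b hab
    refine Multiset.mem_add.2 (Or.inr (Multiset.mem_sum.2 ⟨w, Finset.mem_univ _, ?_⟩))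
    exact Multiset.mem_map.2 ⟨s(a, b), hab, rfl⟩
  have hroot : ∀ w, compMap A B e w (B.root (B.Phi (A.label e))) = Sum.inl (A.attach e w) :=
    fun w => dif_pos rfl
  have hne : ∀ (w : {w // w ∈ A.verts e}) (v : {v // v ≠ B.root (B.Phi (A.label e))}),
      compMap A B e w v.1 = Sum.inr (w, v) := fun w v => dif_neg v.2
  refine ⟨⟨Sum.inl (A.root e)⟩, ?_⟩
  have to_root : ∀ u : CompVertex A B e,
      Relation.ReflTransGen (compConn A B e).Adj u (Sum.inl (A.root e)) := by
    rintro (u | ⟨w, v⟩)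
    · exact hA u _
    · have h := hB w v.1 (B.root (B.Phi (A.label e)))
      rw [hroot, hne] at h
      exact h.trans (hA _ _)
  have from_root : ∀ u : CompVertex A B e,
      Relation.ReflTransGen (compConn A B e).Adj (Sum.inl (A.root e)) u := by
    rintro (u | ⟨w, v⟩)
    · exact hA _ u
    · have h := hB w (B.root (B.Phi (A.label e))) v.1
      rw [hroot, hne] at h
      exact (hA _ _).trans h
  exact fun u v => (to_root u).trans (from_root v)

open Classical in
/-- The gluing data of `R_A ∘ R_B`. The copies of `G` in `R_A(R_B(G))` are indexed by pairs
`(w, w')`. If an edge `f` of `B` is not in the image of `Φ_B`, each copy of `Σ_f` stays as it is and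
gives the edge `{w} × f`. If `f = Φ_B(j)`, the root of `Σ_f` gets the label `j` in `R_B(G)`, and the
copies of `Σ_f` are joined along the edges `e` of `A` labeled `j`, giving the edges `e × f`. -/
noncomputable def comp : GluingData k where
  W := A.W × B.W
  E := A.E ⊕ (A.W × {f : B.E // ¬ ∃ j, B.Phi j = f})
  verts := Sum.elim (fun e => A.verts e ×ˢ B.verts (B.Phi (A.label e)))
    (fun p => {p.1} ×ˢ B.verts p.2.1)
  verts_nonempty := by
    rintro (e | ⟨w, f⟩)
    · exact (A.verts_nonempty e).product (B.verts_nonempty _)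
    · exact (Finset.singleton_nonempty w).product (B.verts_nonempty _)
  label := Sum.elim (fun e => B.label (B.Phi (A.label e))) (fun p => B.label p.2.1)
  existsUnique_edge := by
    rintro ⟨w, w'⟩ ℓ
    obtain ⟨f, ⟨hf, hfl⟩, hfu⟩ := B.existsUnique_edge w' ℓ
    by_cases h : ∃ j, B.Phi j = f
    · obtain ⟨j, hj⟩ := h
      obtain ⟨e, ⟨he, hel⟩, heu⟩ := A.existsUnique_edge w j
      refine ⟨Sum.inl e, ⟨?_, ?_⟩, ?_⟩
      · simp [he, hel, hj, hf]
      · simp [hel, hj, hfl]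
      · rintro (e' | ⟨v, f'⟩) ⟨h1, h2⟩
        · simp only [Sum.elim_inl, Finset.mem_product] at h1 h2
          have h3 := hfu _ ⟨h1.2, h2⟩
          rw [← hj] at h3
          rw [heu e' ⟨h1.1, B.Phi_injective h3⟩]
        · simp only [Sum.elim_inr, Finset.mem_product] at h1 h2
          exact absurd ⟨j, hj.trans (hfu _ ⟨h1.2, h2⟩).symm⟩ f'.2
    · refine ⟨Sum.inr (w, ⟨f, h⟩), ⟨?_, ?_⟩, ?_⟩
      · simp [hf]
      · simp [hfl]
      · rintro (e' | ⟨v, f'⟩) ⟨h1, h2⟩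
        · simp only [Sum.elim_inl, Finset.mem_product] at h1 h2
          exact absurd ⟨_, hfu _ ⟨h1.2, h2⟩⟩ h
        · simp only [Sum.elim_inr, Finset.mem_product, Finset.mem_singleton] at h1 h2
          have h3 : f' = ⟨f, h⟩ := Subtype.ext (hfu _ ⟨h1.2, h2⟩)
          rw [h3, ← h1.1]
  conn := Sum.elim (fun e => compConn A B e) (fun p => B.conn p.2.1)
  conn_connected := by
    rintro (e | p)
    · exact compConn_connected A B e
    · exact B.conn_connected _
  root := fun x => match x with
    | Sum.inl e => (Sum.inl (A.root e) : CompVertex A B e)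
    | Sum.inr p => B.root p.2.1
  attach := fun x => match x with
    | Sum.inl e => fun w =>
        compMap A B e ⟨w.1.1, (Finset.mem_product.1 w.2).1⟩
          (B.attach _ ⟨w.1.2, (Finset.mem_product.1 w.2).2⟩)
    | Sum.inr p => fun w => B.attach p.2.1 ⟨w.1.2, (Finset.mem_product.1 w.2).2⟩
  Phi := fun j => Sum.inl (A.Phi j)
  Phi_injective := Sum.inl_injective.comp A.Phi_injective

end Composition

section Conditions

variable (D : GluingData k)

/-- The gluing data of the iterate `R^{n+1}`. -/
noncomputable def iterateSucc : ℕ → GluingData k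
  | 0 => D
  | n + 1 => comp D (iterateSucc n)

/-- The dynamics `Λ` on the label set. -/
def labelMap (j : Fin k) : Fin k :=
  D.label (D.Phi j)

def IsCritical (j : Fin k) : Prop :=
  2 ≤ (D.verts (D.Phi j)).card

def IsNondegenerate : Prop :=
  ∀ j ∈ Function.periodicPts D.labelMap, ¬ D.IsCritical j

def IsStable : Prop :=
  D.IsNondegenerate ∧
    ∀ j ∈ Function.periodicPts D.labelMap, (D.conn (D.Phi j)).IsSingleton

/-- For some iterate `R^{n+1}`, `n ≥ 0`, the edges `Φ_{n+1}(j)` are pairwise disjoint. -/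
def IsExpanding : Prop :=
  ∃ n : ℕ, ∀ j l : Fin k, j ≠ l →
    Disjoint ((D.iterateSucc n).verts ((D.iterateSucc n).Phi j))
      ((D.iterateSucc n).verts ((D.iterateSucc n).Phi l))

end Conditions

end GluingData

/-!
Near `λ = ∞`, write the partition function of `G_n` with prescribed marked values as a constant
times a product state times a density `r` that is close to `1`. Because the graphs `Σ_e` are
finite and all weights are polynomials in `λ` with coefficients in `ℕ`, there is no cancellation
near infinity: one step of the recursion multiplies one copy of `r` for every vertex of `H` and
averages the product over the choices in each `Σ_e`, against complex kernels with total masses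
`1` and total variations at most `2`.

Two quantities of a density control its averages: the influence of a single coordinate and the
interaction of two coordinates, a multiplicative second difference. Influences alone would grow,
since periodic labels carry them along forever. Stability makes the averages at periodic labels
trivial, so that there the only gain in influence is of the size of the interactions.
Interactions are passed on, up to a quadratic error, only from a pair `Λ(j)`, `Λ(l)` to a pair
`j`, `l` whose edges `Φ(j)` and `Φ(l)` meet, and expansion says that chains of such pairs are
finite. In suitable weights the interactions are therefore halved in each step, the influences
stay bounded by a geometric series, and the product states run through a finite set. Hence
`Z_{G_n}` is, uniformly in `n`, a small relative perturbation of a nonzero sum without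
cancellation.
-/

section NearOne

theorem norm_mul_sub_one_le {R : Type*} [SeminormedRing R] {x y : R} {a b : ℝ}
    (hx : ‖x - 1‖ ≤ a) (hy : ‖y - 1‖ ≤ b) : ‖x * y - 1‖ ≤ (1 + a) * (1 + b) - 1 := by
  have hxy : ‖(x - 1) * (y - 1)‖ ≤ a * b :=
    (norm_mul_le _ _).trans (mul_le_mul hx hy (norm_nonneg _) ((norm_nonneg _).trans hx))
  calc ‖x * y - 1‖ = ‖(x - 1) + (y - 1) + (x - 1) * (y - 1)‖ := by congr 1; noncomm_ring
    _ ≤ ‖x - 1‖ + ‖y - 1‖ + ‖(x - 1) * (y - 1)‖ := norm_add₃_le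
    _ ≤ (1 + a) * (1 + b) - 1 := by linarith

variable {𝕜 : Type*} [NormedField 𝕜]

theorem norm_le_one_add {x : 𝕜} {a : ℝ} (hx : ‖x - 1‖ ≤ a) : ‖x‖ ≤ 1 + a := by
  have h := norm_add_le (x - 1) 1
  rw [sub_add_cancel, norm_one] at h
  linarith

theorem one_sub_le_norm {x : 𝕜} {a : ℝ} (hx : ‖x - 1‖ ≤ a) : 1 - a ≤ ‖x‖ := by
  have h := norm_sub_le x (x - 1)
  rw [sub_sub_cancel, norm_one] at h
  linarith

theorem norm_div_sub_one_le_iff {x y : 𝕜} {a : ℝ} (hy : y ≠ 0) :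
    ‖x / y - 1‖ ≤ a ↔ ‖x - y‖ ≤ a * ‖y‖ := by
  rw [div_sub_one hy, norm_div, div_le_iff₀ (norm_pos_iff.2 hy)]

theorem norm_sum_mul_le {τ : Type*} [Fintype τ] {p g : τ → 𝕜} {A B : ℝ} (hp : ∑ t, ‖p t‖ ≤ A)
    (hB : 0 ≤ B) (hg : ∀ t, ‖g t‖ ≤ B) : ‖∑ t, p t * g t‖ ≤ A * B := by
  calc ‖∑ t, p t * g t‖ ≤ ∑ t, ‖p t‖ * B := by
        refine norm_sum_le_of_le _ fun t _ => ?_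
        rw [norm_mul]
        exact mul_le_mul_of_nonneg_left (hg t) (norm_nonneg _)
    _ = (∑ t, ‖p t‖) * B := (Finset.sum_mul ..).symm
    _ ≤ A * B := mul_le_mul_of_nonneg_right hp hB

theorem norm_sum_mul_sum_sub_le {τ : Type*} [Fintype τ] {p q g : τ → 𝕜} {A B d : ℝ}
    (hp : ∑ t, ‖p t‖ ≤ A) (hq : ∑ t, ‖q t‖ ≤ B) (hd : 0 ≤ d) (hg : ∀ t t', ‖g t - g t'‖ ≤ d) :
    ‖(∑ t, p t) * (∑ t, q t * g t) - (∑ t, q t) * (∑ t, p t * g t)‖ ≤ A * B * d := by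
  have hrow : ∀ t, ‖∑ t', q t' * (g t' - g t)‖ ≤ B * d := fun t =>
    norm_sum_mul_le hq hd fun t' => hg t' t
  have hB : 0 ≤ B * d := mul_nonneg ((Finset.sum_nonneg fun _ _ => norm_nonneg _).trans hq) hd
  calc _ = ‖∑ t, p t * ∑ t', q t' * (g t' - g t)‖ := by
        simp only [mul_sub, Finset.sum_sub_distrib, ← Finset.sum_mul, mul_left_comm (p _)]
        rw [← Finset.mul_sum]
    _ ≤ A * (B * d) := norm_sum_mul_le hp hB hrow
    _ = A * B * d := (mul_assoc _ _ _).symm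

theorem norm_sum_mul_sum_mul_mul_sub_le {τ : Type*} [Fintype τ] {p g g' : τ → 𝕜} {A d d' : ℝ}
    (hp : ∑ t, ‖p t‖ ≤ A) (hd : 0 ≤ d) (hd' : 0 ≤ d') (hg : ∀ t t', ‖g t - g t'‖ ≤ d)
    (hg' : ∀ t t', ‖g' t - g' t'‖ ≤ d') :
    ‖(∑ t, p t) * (∑ t, p t * (g t * g' t)) - (∑ t, p t * g t) * (∑ t, p t * g' t)‖ ≤
      A ^ 2 * (d * d') := by
  rcases isEmpty_or_nonempty τ with _ | ⟨⟨t₀⟩⟩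
  · simp only [Finset.univ_eq_empty, Finset.sum_empty, mul_zero, sub_zero, norm_zero]
    positivity
  have hq : ∑ t, ‖p t * (g' t - g' t₀)‖ ≤ A * d' := by
    simp only [norm_mul]
    calc _ ≤ ∑ t, ‖p t‖ * d' :=
          Finset.sum_le_sum fun t _ => mul_le_mul_of_nonneg_left (hg' t t₀) (norm_nonneg _)
      _ = (∑ t, ‖p t‖) * d' := (Finset.sum_mul ..).symm
      _ ≤ A * d' := mul_le_mul_of_nonneg_right hp hd'
  calc _ = ‖(∑ t, p t) * (∑ t, p t * (g' t - g' t₀) * g t) -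
        (∑ t, p t * (g' t - g' t₀)) * (∑ t, p t * g t)‖ := by
        simp only [mul_sub, sub_mul, Finset.sum_sub_distrib, ← Finset.sum_mul,
          mul_right_comm (p _) (g' t₀)]
        simp only [mul_comm (g _), mul_assoc]
        congr 1
        ring
    _ ≤ A * (A * d') * d := norm_sum_mul_sum_sub_le hp hq hd hg
    _ = A ^ 2 * (d * d') := by ring

theorem norm_sum_mul_sum_mul_mul_mul_sub_le {τ : Type*} [Fintype τ] {p g g' c : τ → 𝕜}
    {A B B' d d' e : ℝ} (hp : ∑ t, ‖p t‖ ≤ A) (hd : 0 ≤ d) (hd' : 0 ≤ d') (he : 0 ≤ e)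
    (hB : 0 ≤ B) (hB' : 0 ≤ B') (hg : ∀ t, ‖g t‖ ≤ B) (hg' : ∀ t, ‖g' t‖ ≤ B')
    (hgg : ∀ t t', ‖g t - g t'‖ ≤ d) (hgg' : ∀ t t', ‖g' t - g' t'‖ ≤ d')
    (hc : ∀ t, ‖c t - 1‖ ≤ e) :
    ‖(∑ t, p t) * (∑ t, p t * (g t * g' t * c t)) - (∑ t, p t * g t) * (∑ t, p t * g' t)‖ ≤
      A ^ 2 * (B * B' * e + d * d') := by
  have hp' : ‖∑ t, p t‖ ≤ A := (norm_sum_le _ _).trans hp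
  have hggc : ∀ t, ‖g t * g' t * (c t - 1)‖ ≤ B * B' * e := fun t => by
    rw [norm_mul, norm_mul]
    exact mul_le_mul (mul_le_mul (hg t) (hg' t) (norm_nonneg _) hB) (hc t) (norm_nonneg _)
      (mul_nonneg hB hB')
  calc _ = ‖(∑ t, p t) * (∑ t, p t * (g t * g' t * (c t - 1))) +
        ((∑ t, p t) * (∑ t, p t * (g t * g' t)) - (∑ t, p t * g t) * (∑ t, p t * g' t))‖ := by
        simp only [mul_sub, Finset.sum_sub_distrib, mul_one]
        congr 1
        ring
    _ ≤ A * (A * (B * B' * e)) + A ^ 2 * (d * d') := by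
        refine norm_add_le_of_le ?_ (norm_sum_mul_sum_mul_mul_sub_le hp hd hd' hgg hgg')
        rw [norm_mul]
        exact mul_le_mul hp' (norm_sum_mul_le hp (by positivity) hggc) (norm_nonneg _)
          ((norm_nonneg _).trans hp')
    _ = A ^ 2 * (B * B' * e + d * d') := by ring

theorem sum_mul_ne_zero {τ : Type*} [Fintype τ] {p g : τ → 𝕜} (hp : ∑ t, p t ≠ 0)
    (hdom : ∑ t, ‖p t‖ ≤ 2 * ‖∑ t, p t‖) (hg : ∀ t, ‖g t - 1‖ ≤ 1 / 4) :
    ∑ t, p t * g t ≠ 0 := by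
  intro h0
  have hsub : ∑ t, p t * (g t - 1) = -∑ t, p t := by
    simp only [mul_sub, mul_one, Finset.sum_sub_distrib, h0, zero_sub]
  have h := norm_sum_mul_le hdom (by norm_num) hg
  rw [hsub, norm_neg] at h
  linarith [norm_pos_iff.2 hp]

theorem one_add_pow_sub_one_le (n : ℕ) {x : ℝ} (h0 : 0 ≤ x) (h1 : x ≤ 1) :
    (1 + x) ^ n - 1 ≤ (2 ^ n - 1) * x := by
  induction n with
  | zero => simp
  | succ n ih =>
    have h2 : (1 : ℝ) ≤ 2 ^ n := one_le_pow₀ (by norm_num)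
    calc (1 + x) ^ (n + 1) - 1 = ((1 + x) ^ n - 1) * (1 + x) + x := by ring
      _ ≤ (2 ^ n - 1) * x * (1 + x) + x := by gcongr
      _ ≤ (2 ^ n - 1) * x * (1 + 1) + x := by
        have := mul_nonneg (sub_nonneg.2 h2) h0
        gcongr
      _ = (2 ^ (n + 1) - 1) * x := by ring

open Filter Bornology in
theorem eventually_norm_sum_pow_div_sub_one_le {ι : Type*}
    {A : Finset ι} {f : ι → ℕ} {i : ι} (hi : i ∈ A) (hlt : ∀ j ∈ A, j ≠ i → f j < f i) {η : ℝ}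
    (hη : 0 < η) : ∀ᶠ z : 𝕜 in cobounded 𝕜, ‖(∑ j ∈ A, z ^ f j) / z ^ f i - 1‖ ≤ η := by
  classical
  have hlittle : (fun z : 𝕜 => ∑ j ∈ A.erase i, z ^ f j) =o[cobounded 𝕜] fun z => z ^ f i :=
    .fun_sum fun j hj => Asymptotics.isLittleO_pow_pow_cobounded_of_lt
      (hlt j (Finset.mem_of_mem_erase hj) (Finset.ne_of_mem_erase hj))
  filter_upwards [hlittle.def hη, eventually_ne_cobounded 0] with z hz hz0
  rwa [norm_div_sub_one_le_iff (pow_ne_zero _ hz0), ← Finset.add_sum_erase A _ hi,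
    add_sub_cancel_left]

end NearOne

section Influence

open Function

variable {𝕜 : Type*} [NormedField 𝕜] {ι : Type*} [DecidableEq ι] {S : ι → Type*}

/-- The multiplicative second difference of `f` in the coordinates `i` and `j`. It is `1` if `f`
is a product of functions of single coordinates. -/
noncomputable def mixedRatio (f : (∀ i, S i) → 𝕜) (s : ∀ i, S i) (i j : ι) (t : S i) (u : S j) :
    𝕜 :=
  f s * f (update (update s i t) j u) / (f (update s i t) * f (update s j u))

theorem mixedRatio_comm (f : (∀ i, S i) → 𝕜) (s : ∀ i, S i) {i j : ι} (h : i ≠ j) (t : S i)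
    (u : S j) : mixedRatio f s i j t u = mixedRatio f s j i u t := by
  unfold mixedRatio
  rw [update_comm h, mul_comm (f (update s i t))]

theorem mixedRatio_mul (f g : (∀ i, S i) → 𝕜) (s : ∀ i, S i) (i j : ι) (t : S i)
    (u : S j) : mixedRatio (fun s => f s * g s) s i j t u =
      mixedRatio f s i j t u * mixedRatio g s i j t u := by
  unfold mixedRatio
  rw [div_mul_div_comm]
  congr 1 <;> ring

/-- A nowhere vanishing function whose relative change is at most `a i` when the coordinate `i` is
altered, and whose coordinates `i` and `j` interact by at most `b i j`. -/
structure HasInfluence (f : (∀ i, S i) → 𝕜) (a : ι → ℝ) (b : ι → ι → ℝ) : Prop where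
  ne_zero : ∀ s, f s ≠ 0
  influence : ∀ s i t, ‖f (update s i t) / f s - 1‖ ≤ a i
  interaction : ∀ s i j, i ≠ j → ∀ t u, ‖mixedRatio f s i j t u - 1‖ ≤ b i j

/-- A kernel with total masses `1` and total variations at most `2`. -/
structure IsAveraging {σ : Type*} [Fintype σ] (κ : Matrix σ σ 𝕜) : Prop where
  sum_eq_one : ∀ s, ∑ t, κ s t = 1
  sum_norm_le : ∀ s, ∑ t, ‖κ s t‖ ≤ 2

/-- The average of `f` over the coordinate `o` against the kernel `κ`. -/
def siteAverage (f : (∀ i, S i) → 𝕜) (o : ι) [Fintype (S o)] (κ : Matrix (S o) (S o) 𝕜)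
    (s : ∀ i, S i) : 𝕜 :=
  ∑ t, κ (s o) t * f (update s o t)

theorem siteAverage_update_self (f : (∀ i, S i) → 𝕜) (o : ι) [Fintype (S o)]
    (κ : Matrix (S o) (S o) 𝕜) (s : ∀ i, S i) (x : S o) :
    siteAverage f o κ (update s o x) = ∑ t, κ x t * f (update s o t) := by
  simp only [siteAverage, update_self, update_idem]

namespace HasInfluence

section Basic

variable {f g : (∀ i, S i) → 𝕜} {a a' : ι → ℝ} {b b' : ι → ι → ℝ}

theorem mono (h : HasInfluence f a b) (ha : ∀ i, a i ≤ a' i)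
    (hb : ∀ i j, i ≠ j → b i j ≤ b' i j) : HasInfluence f a' b' :=
  ⟨h.ne_zero, fun s i t => (h.influence s i t).trans (ha i),
    fun s i j hij t u => (h.interaction s i j hij t u).trans (hb i j hij)⟩

theorem swap (h : HasInfluence f a b) : HasInfluence f a fun i j => b j i :=
  ⟨h.ne_zero, h.influence, fun s i j hij t u =>
    mixedRatio_comm f s hij t u ▸ h.interaction s j i hij.symm u t⟩

theorem influence_nonneg [∀ i, Nonempty (S i)] (h : HasInfluence f a b) (i : ι) : 0 ≤ a i :=
  (norm_nonneg _).trans (h.influence (fun _ => Classical.arbitrary _) i (Classical.arbitrary _))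

theorem interaction_nonneg [∀ i, Nonempty (S i)] (h : HasInfluence f a b) {i j : ι} (hij : i ≠ j) :
    0 ≤ b i j :=
  (norm_nonneg _).trans (h.interaction (fun _ => Classical.arbitrary _) i j hij
    (Classical.arbitrary _) (Classical.arbitrary _))

theorem one : HasInfluence (fun _ : ∀ i, S i => (1 : 𝕜)) (fun _ => 0) (fun _ _ => 0) := by
  refine ⟨fun _ => one_ne_zero, fun _ _ _ => ?_, fun _ _ _ _ _ _ => ?_⟩ <;> simp [mixedRatio]

theorem mul (hf : HasInfluence f a b) (hg : HasInfluence g a' b') :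
    HasInfluence (fun s => f s * g s) (fun i => (1 + a i) * (1 + a' i) - 1)
      (fun i j => (1 + b i j) * (1 + b' i j) - 1) where
  ne_zero s := mul_ne_zero (hf.ne_zero s) (hg.ne_zero s)
  influence s i t := by
    rw [← div_mul_div_comm]
    exact norm_mul_sub_one_le (hf.influence s i t) (hg.influence s i t)
  interaction s i j hij t u := by
    rw [mixedRatio_mul]
    exact norm_mul_sub_one_le (hf.interaction s i j hij t u) (hg.interaction s i j hij t u)

theorem prod {κ : Type*} (A : Finset κ) {f : κ → (∀ i, S i) → 𝕜} {a : κ → ι → ℝ}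
    {b : κ → ι → ι → ℝ} (h : ∀ w, HasInfluence (f w) (a w) (b w)) :
    HasInfluence (fun s => ∏ w ∈ A, f w s) (fun i => ∏ w ∈ A, (1 + a w i) - 1)
      (fun i j => ∏ w ∈ A, (1 + b w i j) - 1) := by
  classical
  induction A using Finset.induction_on with
  | empty => simpa using (one : HasInfluence (fun _ : ∀ i, S i => (1 : 𝕜)) _ _)
  | insert w A hw ih =>
    have := (h w).mul ih
    simp only [add_sub_cancel] at this
    simpa only [Finset.prod_insert hw] using this

theorem norm_div_sub_div_le (h : HasInfluence f a b) {o i : ι} (hi : o ≠ i)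
    (s : ∀ i, S i) (u : S i) (t t' : S o) :
    ‖f (update (update s o t) i u) / f (update s o t) -
      f (update (update s o t') i u) / f (update s o t')‖ ≤ (1 + a i) * b o i := by
  have h1 := h.ne_zero (update s o t)
  have h2 := h.ne_zero (update s o t')
  have h3 := h.ne_zero (update (update s o t') i u)
  have hγ := h.interaction (update s o t') o i hi t u
  have hα := norm_le_one_add (h.influence (update s o t') i u)
  calc _ = ‖f (update (update s o t') i u) / f (update s o t') *
        (mixedRatio f (update s o t') o i t u - 1)‖ := by
        simp only [mixedRatio, update_idem]
        congr 1
        field_simp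
    _ ≤ (1 + a i) * b o i := by
        rw [norm_mul]
        exact mul_le_mul hα hγ (norm_nonneg _) ((norm_nonneg _).trans hα)

theorem comp {ι' : Type*} [DecidableEq ι'] {S' : ι' → Type*} {f : (∀ j, S' j) → 𝕜} {a : ι' → ℝ}
    {b : ι' → ι' → ℝ} (h : HasInfluence f a b) {φ : (∀ i, S i) → ∀ j, S' j} {p : ι → Prop}
    [DecidablePred p] {σ : ι → ι'} (τ : ∀ i, p i → S i → S' (σ i))
    (hφ : ∀ s i (hi : p i) t, φ (update s i t) = update (φ s) (σ i) (τ i hi t))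
    (hφ' : ∀ s i, ¬ p i → ∀ t, φ (update s i t) = φ s)
    (hσ : ∀ i j, p i → p j → σ i = σ j → i = j) :
    HasInfluence (fun s => f (φ s)) (fun i => if p i then a (σ i) else 0)
      (fun i j => if p i ∧ p j then b (σ i) (σ j) else 0) := by
  refine ⟨fun s => h.ne_zero _, fun s i t => ?_, fun s i j hij t u => ?_⟩
  · split_ifs with hi
    · rw [hφ s i hi]
      exact h.influence _ _ _
    · rw [hφ' s i hi, div_self (h.ne_zero _), sub_self, norm_zero]
  · have hcancel : ∀ x y, f (φ x) * f (φ y) / (f (φ x) * f (φ y)) = 1 := fun x y =>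
      div_self (mul_ne_zero (h.ne_zero _) (h.ne_zero _))
    change ‖f (φ s) * f (φ (update (update s i t) j u)) /
      (f (φ (update s i t)) * f (φ (update s j u))) - 1‖ ≤ _
    split_ifs with hp
    · obtain ⟨hi, hj⟩ := hp
      rw [hφ _ j hj, hφ _ i hi, hφ _ j hj]
      exact h.interaction _ _ _ (fun hσij => hij (hσ i j hi hj hσij)) _ _
    · by_cases hj : p j
      · have hi : ¬ p i := fun hi => hp ⟨hi, hj⟩
        rw [hφ _ j hj, hφ' _ i hi, ← hφ _ j hj, hcancel, sub_self, norm_zero]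
      · rw [hφ' _ j hj, hφ' _ j hj, mul_comm, hcancel, sub_self, norm_zero]

theorem of_norm_sub_one_le {η : ℝ} (hη : η ≤ 1 / 4) (h : ∀ s, ‖f s - 1‖ ≤ η) :
    HasInfluence f (fun _ => 12 * η) (fun _ _ => 12 * η) := by
  have hnorm : ∀ s, 3 / 4 ≤ ‖f s‖ := fun s => by linarith [one_sub_le_norm (h s)]
  have hne : ∀ s, f s ≠ 0 := fun s => norm_pos_iff.1 (by linarith [hnorm s])
  have hdiv : ∀ s t, ‖f s / f t - 1‖ ≤ 3 * η := by
    intro s t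
    have hη0 : 0 ≤ η := (norm_nonneg _).trans (h s)
    rw [norm_div_sub_one_le_iff (hne t)]
    calc ‖f s - f t‖ = ‖(f s - 1) - (f t - 1)‖ := by rw [sub_sub_sub_cancel_right]
      _ ≤ η + η := norm_sub_le_of_le (h s) (h t)
      _ ≤ 3 * η * (3 / 4) := by linarith
      _ ≤ 3 * η * ‖f t‖ := by gcongr; exact hnorm t
  refine ⟨hne, fun s i t => ?_, fun s i j _ t u => ?_⟩
  · exact (hdiv _ _).trans (by linarith [(norm_nonneg _).trans (h s)])
  · rw [mixedRatio, mul_div_mul_comm]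
    refine (norm_mul_sub_one_le (hdiv _ _) (hdiv _ _)).trans ?_
    nlinarith [(norm_nonneg _).trans (h s)]

theorem norm_div_sub_one_le (h : HasInfluence f a b)
    {s t : ∀ i, S i} (A : Finset ι) (hst : ∀ i ∉ A, s i = t i) :
    ‖f s / f t - 1‖ ≤ ∏ i ∈ A, (1 + a i) - 1 := by
  induction A using Finset.induction_on generalizing s with
  | empty =>
    obtain rfl : s = t := funext fun i => hst i (Finset.notMem_empty i)
    simp [div_self (h.ne_zero s)]
  | insert o A ho ih =>
    have hupdate : ‖f (update s o (t o)) / f t - 1‖ ≤ ∏ i ∈ A, (1 + a i) - 1 := by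
      refine ih fun i hi => ?_
      rcases eq_or_ne i o with rfl | hio
      · rw [update_self]
      · rw [update_of_ne hio, hst i (by simp [hio, hi])]
    have hlast := h.influence (update s o (t o)) o (s o)
    rw [update_idem, update_eq_self] at hlast
    have hmul := norm_mul_sub_one_le hlast hupdate
    rwa [div_mul_div_cancel₀ (h.ne_zero _), add_sub_cancel,
      ← Finset.prod_insert (f := fun i => 1 + a i) ho] at hmul

end Basic

section SiteAverage

variable {f : (∀ i, S i) → 𝕜} {a : ι → ℝ} {b : ι → ι → ℝ} (h : HasInfluence f a b)
  {o : ι} [Fintype (S o)] {κ : Matrix (S o) (S o) 𝕜}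

include h

theorem norm_update_sub_le (s : ∀ i, S i) (i : ι) (t : S i) :
    ‖f (update s i t) - f s‖ ≤ a i * ‖f s‖ :=
  (norm_div_sub_one_le_iff (h.ne_zero s)).1 (h.influence s i t)

theorem siteAverage_update_of_ne {i : ι} (hi : o ≠ i) (s : ∀ i, S i) (u : S i) :
    siteAverage f o κ (update s i u) = ∑ t, κ (s o) t * f (update s o t) *
      (f (update (update s o t) i u) / f (update s o t)) := by
  refine Finset.sum_congr rfl fun t _ => ?_
  rw [update_of_ne hi, update_comm hi.symm, mul_assoc, mul_div_cancel₀ _ (h.ne_zero _)]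

theorem siteAverage_update_update {i j : ι} (hi : o ≠ i) (hj : o ≠ j) (s : ∀ i, S i) (t : S i)
    (u : S j) :
    siteAverage f o κ (update (update s i t) j u) = ∑ r, κ (s o) r * f (update s o r) *
      (f (update (update s o r) i t) / f (update s o r) *
        (f (update (update s o r) j u) / f (update s o r)) *
        mixedRatio f (update s o r) i j t u) := by
  refine Finset.sum_congr rfl fun r _ => ?_
  have h0 := h.ne_zero (update s o r)
  have hi0 := h.ne_zero (update (update s o r) i t)
  have hj0 := h.ne_zero (update (update s o r) j u)
  rw [mixedRatio, update_of_ne hj, update_of_ne hi, update_comm hj.symm, update_comm hi.symm]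
  field_simp

variable (hκ : IsAveraging κ)

include hκ

theorem norm_siteAverage_update_sub_le (s : ∀ i, S i) (x : S o) :
    ‖siteAverage f o κ (update s o x) - f s‖ ≤ 2 * a o * ‖f s‖ := by
  calc _ = ‖∑ t, κ x t * (f (update s o t) - f s)‖ := by
        simp only [siteAverage_update_self, mul_sub, Finset.sum_sub_distrib, ← Finset.sum_mul,
          hκ.sum_eq_one, one_mul]
    _ ≤ 2 * (a o * ‖f s‖) := norm_sum_mul_le (hκ.sum_norm_le x)
        ((norm_nonneg _).trans (h.norm_update_sub_le s o x)) (h.norm_update_sub_le s o)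
    _ = 2 * a o * ‖f s‖ := (mul_assoc _ _ _).symm

variable (ho : a o ≤ 1 / 8)

include ho

theorem le_norm_siteAverage (s : ∀ i, S i) (x : S o) :
    3 / 4 * ‖f s‖ ≤ ‖siteAverage f o κ (update s o x)‖ := by
  have h1 := h.norm_siteAverage_update_sub_le hκ s x
  have h2 := norm_sub_norm_le (f s) (siteAverage f o κ (update s o x))
  have h3 := mul_le_mul_of_nonneg_right ho (norm_nonneg (f s))
  rw [norm_sub_rev] at h2
  linarith

theorem le_norm_siteAverage_update {i : ι} (hi : a i ≤ 1 / 8) (s : ∀ i, S i) (u : S i) :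
    21 / 32 * ‖f s‖ ≤ ‖siteAverage f o κ (update s i u)‖ := by
  have h1 := h.le_norm_siteAverage hκ ho (update s i u) (update s i u o)
  rw [update_eq_self] at h1
  have h2 := one_sub_le_norm (h.influence s i u)
  rw [norm_div, le_div_iff₀ (norm_pos_iff.2 (h.ne_zero s))] at h2
  have h3 := mul_le_mul_of_nonneg_right hi (norm_nonneg (f s))
  linarith

theorem sum_norm_mul_le (s : ∀ i, S i) (x : S o) :
    ∑ t, ‖κ x t * f (update s o t)‖ ≤ 9 / 4 * ‖f s‖ := by
  have hf : ∀ t, ‖f (update s o t)‖ ≤ 9 / 8 * ‖f s‖ := fun t => by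
    have h1 := norm_le_one_add (h.influence s o t)
    rw [norm_div, div_le_iff₀ (norm_pos_iff.2 (h.ne_zero s))] at h1
    exact h1.trans (mul_le_mul_of_nonneg_right (by linarith) (norm_nonneg _))
  calc ∑ t, ‖κ x t * f (update s o t)‖ ≤ ∑ t, ‖κ x t‖ * (9 / 8 * ‖f s‖) :=
        Finset.sum_le_sum fun t _ => by
          rw [norm_mul]
          exact mul_le_mul_of_nonneg_left (hf t) (norm_nonneg _)
    _ = (∑ t, ‖κ x t‖) * (9 / 8 * ‖f s‖) := (Finset.sum_mul ..).symm
    _ ≤ 2 * (9 / 8 * ‖f s‖) := mul_le_mul_of_nonneg_right (hκ.sum_norm_le x) (by positivity)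
    _ = 9 / 4 * ‖f s‖ := by ring

theorem siteAverage_influence_self (s : ∀ i, S i) (x : S o) :
    ‖siteAverage f o κ (update s o x) / siteAverage f o κ s - 1‖ ≤ 6 * a o := by
  have h0 := h.le_norm_siteAverage hκ ho s (s o)
  have hx := h.norm_siteAverage_update_sub_le hκ s x
  have hs := h.norm_siteAverage_update_sub_le hκ s (s o)
  rw [update_eq_self] at h0 hs
  have hf := norm_pos_iff.2 (h.ne_zero s)
  have ha : 0 ≤ a o := (norm_nonneg _).trans (h.influence s o x)
  rw [norm_div_sub_one_le_iff (norm_pos_iff.1 (by linarith))]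
  have htri := norm_sub_le_norm_sub_add_norm_sub (siteAverage f o κ (update s o x)) (f s)
    (siteAverage f o κ s)
  rw [norm_sub_rev (f s)] at htri
  nlinarith [mul_nonneg ha hf.le, mul_le_mul_of_nonneg_left h0 ha]

theorem siteAverage_influence_of_ne {i : ι} (hoi : o ≠ i) (hi : a i ≤ 1 / 8) (s : ∀ i, S i)
    (u : S i) :
    ‖siteAverage f o κ (update s i u) / siteAverage f o κ s - 1‖ ≤
      a i + 4 * b o i := by
  have h0 := h.le_norm_siteAverage hκ ho s (s o)
  have hf := norm_pos_iff.2 (h.ne_zero s)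
  have ha : 0 ≤ a i := (norm_nonneg _).trans (h.influence s i u)
  have hb : 0 ≤ b o i := (norm_nonneg _).trans (h.interaction s o i hoi (s o) u)
  have hα := fun t => h.norm_div_sub_div_le hoi s u t (s o)
  have hp := h.sum_norm_mul_le hκ ho s (s o)
  simp only [update_eq_self] at h0 hα
  have hsum := norm_sum_mul_le hp (by positivity) hα
  set α := f (update s i u) / f s
  have hshift : siteAverage f o κ (update s i u) - siteAverage f o κ s =
      (∑ t, κ (s o) t * f (update s o t) *
        (f (update (update s o t) i u) / f (update s o t) - α)) +
      (α - 1) * siteAverage f o κ s := by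
    rw [h.siteAverage_update_of_ne hoi]
    simp only [mul_sub, Finset.sum_sub_distrib, ← Finset.sum_mul]
    unfold siteAverage
    ring
  rw [norm_div_sub_one_le_iff (norm_pos_iff.1 (by linarith)), hshift]
  calc _ ≤ 9 / 4 * ‖f s‖ * ((1 + a i) * b o i) + a i * ‖siteAverage f o κ s‖ := by
        refine norm_add_le_of_le hsum ?_
        rw [norm_mul]
        exact mul_le_mul_of_nonneg_right (h.influence s i u) (norm_nonneg _)
    _ ≤ 9 / 4 * (4 / 3 * ‖siteAverage f o κ s‖) * ((1 + 1 / 8) * b o i) +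
        a i * ‖siteAverage f o κ s‖ := by
        gcongr
        linarith
    _ ≤ (a i + 4 * b o i) * ‖siteAverage f o κ s‖ := by
        nlinarith [mul_nonneg hb (norm_nonneg (siteAverage f o κ s))]

theorem siteAverage_interaction_left {j : ι} (hoj : o ≠ j) (hj : a j ≤ 1 / 8) (s : ∀ i, S i)
    (x : S o) (u : S j) :
    ‖mixedRatio (siteAverage f o κ) s o j x u - 1‖ ≤ 12 * b o j := by
  have hf := norm_pos_iff.2 (h.ne_zero s)
  have ha : 0 ≤ a j := (norm_nonneg _).trans (h.influence s j u)
  have hb : 0 ≤ b o j := (norm_nonneg _).trans (h.interaction s o j hoj x u)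
  have hx := h.le_norm_siteAverage hκ ho s x
  have hu := h.le_norm_siteAverage_update hκ ho hj s u
  have hcov := norm_sum_mul_sum_sub_le (h.sum_norm_mul_le hκ ho s (s o))
    (h.sum_norm_mul_le hκ ho s x) (by positivity) (h.norm_div_sub_div_le hoj s u)
  have hxu := h.siteAverage_update_of_ne (κ := κ) hoj (update s o x) u
  simp only [update_self, update_idem] at hxu
  rw [← h.siteAverage_update_of_ne hoj, ← hxu, ← siteAverage_update_self,
    ← siteAverage_update_self, update_eq_self] at hcov
  have hx0 : siteAverage f o κ (update s o x) ≠ 0 := norm_pos_iff.1 (by linarith)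
  have hu0 : siteAverage f o κ (update s j u) ≠ 0 := norm_pos_iff.1 (by linarith)
  rw [mixedRatio, norm_div_sub_one_le_iff (mul_ne_zero hx0 hu0), norm_mul]
  calc _ ≤ 9 / 4 * ‖f s‖ * (9 / 4 * ‖f s‖) * ((1 + a j) * b o j) := hcov
    _ ≤ 9 / 4 * ‖f s‖ * (9 / 4 * ‖f s‖) * ((1 + 1 / 8) * b o j) := by gcongr
    _ ≤ 12 * b o j * (3 / 4 * ‖f s‖ * (21 / 32 * ‖f s‖)) := by
        nlinarith [mul_nonneg hb (mul_nonneg hf.le hf.le)]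
    _ ≤ _ := by gcongr

theorem siteAverage_interaction_of_ne {i j : ι} (hij : i ≠ j) (hoi : o ≠ i) (hoj : o ≠ j)
    (hi : a i ≤ 1 / 8) (hj : a j ≤ 1 / 8) (s : ∀ i, S i) (t : S i) (u : S j) :
    ‖mixedRatio (siteAverage f o κ) s i j t u - 1‖ ≤ 15 * (b i j + b o i * b o j) := by
  have hf := norm_pos_iff.2 (h.ne_zero s)
  have hai : 0 ≤ a i := (norm_nonneg _).trans (h.influence s i t)
  have haj : 0 ≤ a j := (norm_nonneg _).trans (h.influence s j u)
  have hboi : 0 ≤ b o i := (norm_nonneg _).trans (h.interaction s o i hoi (s o) t)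
  have hboj : 0 ≤ b o j := (norm_nonneg _).trans (h.interaction s o j hoj (s o) u)
  have hbij : 0 ≤ b i j := (norm_nonneg _).trans (h.interaction s i j hij t u)
  have hFi := h.le_norm_siteAverage_update hκ ho hi s t
  have hFj := h.le_norm_siteAverage_update hκ ho hj s u
  have hFi0 : siteAverage f o κ (update s i t) ≠ 0 := norm_pos_iff.1 (by linarith)
  have hFj0 : siteAverage f o κ (update s j u) ≠ 0 := norm_pos_iff.1 (by linarith)
  have hcov := norm_sum_mul_sum_mul_mul_mul_sub_le (h.sum_norm_mul_le hκ ho s (s o))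
    (by positivity) (by positivity) hbij (by positivity) (by positivity)
    (fun r => norm_le_one_add (h.influence (update s o r) i t))
    (fun r => norm_le_one_add (h.influence (update s o r) j u))
    (h.norm_div_sub_div_le hoi s t) (h.norm_div_sub_div_le hoj s u)
    (fun r => h.interaction (update s o r) i j hij t u)
  rw [← h.siteAverage_update_of_ne hoi, ← h.siteAverage_update_of_ne hoj,
    ← h.siteAverage_update_update hoi hoj, ← siteAverage_update_self, update_eq_self] at hcov
  rw [mixedRatio, norm_div_sub_one_le_iff (mul_ne_zero hFi0 hFj0), norm_mul]
  calc _ ≤ (9 / 4 * ‖f s‖) ^ 2 * ((1 + a i) * (1 + a j) * b i j +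
        (1 + a i) * b o i * ((1 + a j) * b o j)) := hcov
    _ = (9 / 4 * ‖f s‖) ^ 2 * ((1 + a i) * (1 + a j)) * (b i j + b o i * b o j) := by ring
    _ ≤ (9 / 4 * ‖f s‖) ^ 2 * ((1 + 1 / 8) * (1 + 1 / 8)) * (b i j + b o i * b o j) := by gcongr
    _ ≤ 15 * (b i j + b o i * b o j) * (21 / 32 * ‖f s‖ * (21 / 32 * ‖f s‖)) := by
        have : 0 ≤ (b i j + b o i * b o j) * ‖f s‖ ^ 2 := by positivity
        linarith
    _ ≤ _ := by gcongr

end SiteAverage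

protected theorem siteAverage {f : (∀ i, S i) → 𝕜} {a : ι → ℝ} {b : ι → ι → ℝ}
    (h : HasInfluence f a b) {o : ι} [Fintype (S o)] {κ : Matrix (S o) (S o) 𝕜} (hκ : IsAveraging κ)
    {M : ℝ} (ha : ∀ i, a i ≤ 1 / 8) (hb : ∀ i j, i ≠ j → b i j ≤ M) :
    HasInfluence (siteAverage f o κ) (fun i => if i = o then 6 * a i else a i + 4 * M)
      (fun i j => 15 * (b i j + M ^ 2)) where
  ne_zero s := by
    have hs := h.le_norm_siteAverage hκ (ha o) s (s o)
    have hf := norm_pos_iff.2 (h.ne_zero s)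
    rw [update_eq_self] at hs
    exact norm_pos_iff.1 (by linarith)
  influence s i t := by
    split_ifs with hi
    · subst hi
      exact h.siteAverage_influence_self hκ (ha _) s t
    · exact (h.siteAverage_influence_of_ne hκ (ha o) (Ne.symm hi) (ha i) s t).trans
        (by linarith [hb o i (Ne.symm hi)])
  interaction s i j hij t u := by
    have hbij : 0 ≤ b i j := (norm_nonneg _).trans (h.interaction s i j hij t u)
    rcases eq_or_ne o i with rfl | hoi
    · exact (h.siteAverage_interaction_left hκ (ha o) hij (ha j) s t u).trans (by nlinarith)
    rcases eq_or_ne o j with rfl | hoj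
    · rw [mixedRatio_comm _ _ hij]
      exact (h.swap.siteAverage_interaction_left hκ (ha o) hoi (ha i) s u t).trans (by nlinarith)
    have hboi : 0 ≤ b o i := (norm_nonneg _).trans (h.interaction s o i hoi (s o) t)
    have hboj : 0 ≤ b o j := (norm_nonneg _).trans (h.interaction s o j hoj (s o) u)
    refine (h.siteAverage_interaction_of_ne hκ (ha o) hij hoi hoj (ha i) (ha j) s t u).trans ?_
    nlinarith [mul_le_mul (hb o i hoi) (hb o j hoj) hboj (hboi.trans (hb o i hoi))]

end HasInfluence

end Influence

section ProductAverage

open Function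

variable {𝕜 : Type*} [NormedField 𝕜] {ι : Type*} [Fintype ι] [DecidableEq ι] {S : ι → Type*}
  [∀ i, Fintype (S i)]

/-- The average of `f` over all coordinates against the product of the kernels `κ i`. -/
def productAverage (κ : ∀ i, Matrix (S i) (S i) 𝕜) (f : (∀ i, S i) → 𝕜) (s : ∀ i, S i) : 𝕜 :=
  ∑ t : ∀ i, S i, (∏ i, κ i (s i) (t i)) * f t

variable [∀ i, DecidableEq (S i)]

theorem productAverage_one (f : (∀ i, S i) → 𝕜) : productAverage (fun _ => 1) f = f := by
  funext s
  have hdiag : ∀ t : ∀ i, S i, ∏ i, (1 : Matrix (S i) (S i) 𝕜) (s i) (t i) =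
      if s = t then 1 else 0 := fun t => by
    simp only [Matrix.one_apply, Fintype.prod_ite_zero, Finset.prod_const_one, funext_iff]
  simp [productAverage, hdiag]

theorem siteAverage_productAverage (κ : ∀ i, Matrix (S i) (S i) 𝕜) (f : (∀ i, S i) → 𝕜) (o : ι) :
    siteAverage (productAverage (update κ o 1) f) o (κ o) = productAverage κ f := by
  funext s
  have hprod : ∀ (u : S o) (t : ∀ i, S i), ∏ i, update κ o 1 i (update s o u i) (t i) =
      if u = t o then ∏ i ∈ Finset.univ.erase o, κ i (s i) (t i) else 0 := fun u t => by
    rw [← Finset.mul_prod_erase _ _ (Finset.mem_univ o), update_self, update_self,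
      Matrix.one_apply, ite_mul, one_mul, zero_mul]
    refine if_congr Iff.rfl (Finset.prod_congr rfl fun i hi => ?_) rfl
    rw [update_of_ne (Finset.ne_of_mem_erase hi), update_of_ne (Finset.ne_of_mem_erase hi)]
  simp only [siteAverage, productAverage, hprod, Finset.mul_sum]
  rw [Finset.sum_comm]
  refine Finset.sum_congr rfl fun t _ => ?_
  rw [← Finset.mul_prod_erase _ (fun i => κ i (s i) (t i)) (Finset.mem_univ o)]
  simp [mul_assoc]

omit [∀ i, Fintype (S i)] in
theorem IsAveraging.one {σ : Type*} [Fintype σ] [DecidableEq σ] :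
    IsAveraging (1 : Matrix σ σ 𝕜) where
  sum_eq_one s := by simp [Matrix.one_apply]
  sum_norm_le s := by simp [Matrix.one_apply, apply_ite norm]

namespace HasInfluence

omit [Fintype ι] [∀ i, Fintype (S i)] [∀ i, DecidableEq (S i)] in
theorem siteAverage_of_le {f : (∀ i, S i) → 𝕜} {a a' : ι → ℝ} {b : ι → ι → ℝ} {C M : ℝ} {o : ι}
    [Fintype (S o)] {κ : Matrix (S o) (S o) 𝕜} (hκ : IsAveraging κ)
    (h : HasInfluence f a' fun i j => C * (b i j + M ^ 2)) (hC : 1 ≤ C) (hM : 0 ≤ M)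
    (ha : ∀ i, 0 ≤ a i) (ha' : ∀ i, a' i ≤ C * (a i + M)) (hsmall : ∀ i, C * (a i + M) ≤ 1 / 8)
    (hb : ∀ i j, i ≠ j → 0 ≤ b i j ∧ b i j ≤ M) :
    HasInfluence (siteAverage f o κ)
      (fun i => if i = o then 6 * (C * (a i + M)) else a' i + 8 * C * M)
      (fun i j => 75 * C ^ 2 * (b i j + M ^ 2)) := by
  have hM1 : M ≤ 1 := by nlinarith [hsmall o, ha o]
  have hMM : M ^ 2 ≤ M := by nlinarith
  refine (HasInfluence.siteAverage h hκ (M := 2 * C * M) (fun i => (ha' i).trans (hsmall i))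
    fun i j hij => ?_).mono (fun i => ?_) fun i j hij => ?_
  · calc C * (b i j + M ^ 2) ≤ C * (M + M) := by gcongr; exact (hb i j hij).2
      _ = 2 * C * M := by ring
  · split_ifs
    · linarith [ha' i]
    · linarith
  · calc 15 * (C * (b i j + M ^ 2) + (2 * C * M) ^ 2)
        = 15 * (C * (b i j + M ^ 2)) + 60 * C ^ 2 * M ^ 2 := by ring
      _ ≤ 15 * (C ^ 2 * (b i j + M ^ 2)) + 60 * C ^ 2 * (b i j + M ^ 2) := by
        have := (hb i j hij).1
        gcongr
        · exact le_self_pow₀ hC two_ne_zero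
        · linarith
      _ = 75 * C ^ 2 * (b i j + M ^ 2) := by ring

end HasInfluence

open Classical in
/-- `C` is a constant in the bounds for averages over the coordinates in `A`. Coordinates with the
trivial kernel `1` keep their influence, up to a multiple of the bound `M` on the interactions. -/
def BoundsAverages (𝕜 : Type*) [NormedField 𝕜] (S : ι → Type*) [∀ i, Fintype (S i)]
    [∀ i, DecidableEq (S i)] (A : Finset ι) (C : ℝ) : Prop :=
  ∀ (f : (∀ i, S i) → 𝕜) (a : ι → ℝ) (b : ι → ι → ℝ) (M : ℝ) (κ : ∀ i, Matrix (S i) (S i) 𝕜),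
    HasInfluence f a b → 0 ≤ M → (∀ i j, i ≠ j → b i j ≤ M) → (∀ i, C * (a i + M) ≤ 1 / 8) →
    (∀ i, IsAveraging (κ i)) → (∀ i ∉ A, κ i = 1) →
    HasInfluence (productAverage κ f)
      (fun i => if κ i = 1 then a i + C * M else C * (a i + M)) (fun i j => C * (b i j + M ^ 2))

namespace BoundsAverages

variable {A : Finset ι} {C : ℝ}

theorem empty : BoundsAverages 𝕜 S ∅ 1 := by
  intro f a b M κ h hM _ _ _ hκ
  obtain rfl : κ = fun _ => 1 := funext fun i => hκ i (Finset.notMem_empty i)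
  rw [productAverage_one]
  exact h.mono (fun i => by simp [hM]) fun i j _ => by simp [sq_nonneg M]

variable [∀ i, Nonempty (S i)]

theorem mono (h : BoundsAverages 𝕜 S A C) {C' : ℝ} (hCC : C ≤ C') :
    BoundsAverages 𝕜 S A C' := by
  intro f a b M κ hf hM hb hsmall hκ h1
  have ha := hf.influence_nonneg
  have haM : ∀ i, C * (a i + M) ≤ C' * (a i + M) := fun i =>
    mul_le_mul_of_nonneg_right hCC (add_nonneg (ha i) hM)
  refine (h f a b M κ hf hM hb (fun i => (haM i).trans (hsmall i)) hκ h1).mono (fun i => ?_)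
    fun i j hij => ?_
  · split_ifs
    · gcongr
    · exact haM i
  · have := hf.interaction_nonneg hij
    gcongr

theorem insert (h : BoundsAverages 𝕜 S A C) (hC : 1 ≤ C) (o : ι) :
    BoundsAverages 𝕜 S (insert o A) (75 * C ^ 2) := by
  intro f a b M κ hf hM hb hsmall hκ h1
  have hCC : 10 * C ≤ 75 * C ^ 2 := by nlinarith
  by_cases hκo : κ o = 1
  · refine h.mono (by linarith) f a b M κ hf hM hb hsmall hκ fun i hi => ?_
    rcases eq_or_ne i o with rfl | hio
    · exact hκo
    · exact h1 i (by simp [hi, hio])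
  have ha := hf.influence_nonneg
  have haM : ∀ i, 0 ≤ C * (a i + M) := fun i => mul_nonneg (by linarith) (add_nonneg (ha i) hM)
  have hCa : ∀ i, 10 * (C * (a i + M)) ≤ 75 * C ^ 2 * (a i + M) := fun i => by
    rw [← mul_assoc]
    exact mul_le_mul_of_nonneg_right hCC (add_nonneg (ha i) hM)
  have hCM : 10 * (C * M) ≤ 75 * C ^ 2 * M := by
    rw [← mul_assoc]
    exact mul_le_mul_of_nonneg_right hCC hM
  have hCM0 : 0 ≤ C * M := mul_nonneg (by linarith) hM
  rw [← siteAverage_productAverage κ f o]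
  have hsmall' : ∀ i, C * (a i + M) ≤ 1 / 8 := fun i => by linarith [haM i, hCa i, hsmall i]
  have hA := h f a b M (update κ o 1) hf hM hb hsmall'
    ((forall_update_iff κ fun i κ => IsAveraging κ).2 ⟨.one, fun i _ => hκ i⟩)
    fun i hi => by
      rcases eq_or_ne i o with rfl | hio
      · exact update_self ..
      · rw [update_of_ne hio, h1 i (by simp [hi, hio])]
  refine (hA.siteAverage_of_le (hκ o) hC hM ha (fun i => ?_) hsmall' fun i j hij =>
    ⟨hf.interaction_nonneg hij, hb i j hij⟩).mono (fun i => ?_) fun _ _ _ => le_rfl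
  · split_ifs
    · nlinarith [ha i]
    · exact le_rfl
  · rcases eq_or_ne i o with rfl | hio
    · rw [if_pos rfl, if_neg hκo]
      linarith [haM i, hCa i]
    · rw [if_neg hio, update_of_ne hio]
      split_ifs
      · linarith
      · linarith [hCa i, mul_nonneg (zero_le_one.trans hC) (ha i)]

end BoundsAverages

theorem exists_boundsAverages [∀ i, Nonempty (S i)] (A : Finset ι) :
    ∃ C, 1 ≤ C ∧ BoundsAverages 𝕜 S A C := by
  induction A using Finset.induction_on with
  | empty => exact ⟨1, le_rfl, .empty⟩
  | insert o A _ ih =>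
    obtain ⟨C, hC, h⟩ := ih
    exact ⟨75 * C ^ 2, by nlinarith, h.insert hC o⟩

end ProductAverage

section Weight

open Function

theorem exists_iterate_mem_periodicPts {α : Type*} [Finite α] (T : α → α) (x : α) :
    ∃ r, T^[r] x ∈ periodicPts T := by
  obtain ⟨m, n, hmn, h⟩ : ∃ m n, m < n ∧ T^[m] x = T^[n] x := by
    obtain ⟨m, n, hmn, h⟩ := Finite.exists_ne_map_eq_of_infinite fun r => T^[r] x
    rcases hmn.lt_or_gt with hlt | hlt
    exacts [⟨m, n, hlt, h⟩, ⟨n, m, hlt, h.symm⟩]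
  refine ⟨m, mk_mem_periodicPts (Nat.sub_pos_of_lt hmn) ?_⟩
  rw [IsPeriodicPt, IsFixedPt, ← iterate_add_apply, Nat.sub_add_cancel hmn.le, h]

theorem exists_one_le_weight {α : Type*} {T : α → α} {p : α → Prop} (h : ∀ x, ∃ i, ¬ p (T^[i] x))
    {L : ℝ} (hL : 1 ≤ L) :
    ∃ w : α → ℝ, (∀ x, 1 ≤ w x) ∧ (∀ x, ¬ p x → w x = 1) ∧
      ∀ x, p x → L * w (T x) ≤ w x := by
  classical
  refine ⟨fun x => L ^ Nat.find (h x), fun x => one_le_pow₀ hL, fun x hx => ?_, fun x hx => ?_⟩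
  · simp only [(Nat.find_eq_zero (h x)).2 hx, pow_zero]
  rw [← pow_succ']
  refine pow_le_pow_right₀ hL ?_
  obtain ⟨n, hn⟩ : ∃ n, Nat.find (h x) = n + 1 :=
    Nat.exists_eq_succ_of_ne_zero fun h0 => (Nat.find_eq_zero (h x)).1 h0 hx
  have hspec := Nat.find_spec (h x)
  rw [hn, iterate_succ_apply] at hspec
  rw [hn]
  exact Nat.succ_le_succ (Nat.find_min' _ hspec)

end Weight

section NatPolynomial

open Polynomial Filter Bornology

theorem norm_aeval_nat_le (P : ℕ[X]) (z : ℂ) : ‖aeval z P‖ ≤ aeval ‖z‖ P := by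
  rw [aeval_eq_sum_range, aeval_eq_sum_range]
  refine norm_sum_le_of_le _ fun i _ => ?_
  rw [nsmul_eq_mul, nsmul_eq_mul, norm_mul, norm_pow, Complex.norm_natCast]

theorem two_mul_leadingCoeff_mul_pow_le (P : ℕ[X]) (z : ℂ) :
    2 * (P.leadingCoeff * ‖z‖ ^ P.natDegree) ≤ ‖aeval z P‖ + aeval ‖z‖ P := by
  have haeval : ∀ {A : Type} [CommRing A] (x : A),
      aeval x P = aeval x P.eraseLead + P.leadingCoeff * x ^ P.natDegree := fun x => by
    conv_lhs => rw [← eraseLead_add_C_mul_X_pow P]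
    simp
  have hlead : P.leadingCoeff * z ^ P.natDegree = aeval z P - aeval z P.eraseLead := by
    rw [haeval z, add_sub_cancel_left]
  have hnorm := norm_sub_le (aeval z P) (aeval z P.eraseLead)
  rw [← hlead, norm_mul, norm_pow, Complex.norm_natCast] at hnorm
  linarith [haeval ‖z‖, norm_aeval_nat_le P.eraseLead z]

theorem eventually_aeval_norm_le (P : ℕ[X]) :
    ∀ᶠ z : ℂ in cobounded ℂ, aeval ‖z‖ P ≤ 2 * ‖aeval z P‖ := by
  have hlead : ∀ᶠ x : ℝ in atTop,
      3 * aeval x P ≤ 4 * (P.leadingCoeff * x ^ P.natDegree) := by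
    have hinj : Function.Injective (Nat.castRingHom ℝ) := Nat.cast_injective
    have hequiv := (isEquivalent_atTop_lead (P.map (Nat.castRingHom ℝ))).isLittleO.def
      (by norm_num : (0 : ℝ) < 1 / 3)
    filter_upwards [hequiv, eventually_ge_atTop 0] with x hx hx0
    rw [leadingCoeff_map_of_injective hinj, natDegree_map_eq_of_injective hinj, Pi.sub_apply,
      eval_map, Nat.coe_castRingHom, Real.norm_eq_abs, Real.norm_of_nonneg (by positivity)] at hx
    change 3 * eval₂ (Nat.castRingHom ℝ) x P ≤ _
    linarith [(abs_le.1 hx).2]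
  filter_upwards [tendsto_norm_cobounded_atTop.eventually hlead] with z hz
  linarith [two_mul_leadingCoeff_mul_pow_le P z]

theorem eventually_aeval_ne_zero {P : ℕ[X]} (hP : P ≠ 0) :
    ∀ᶠ z : ℂ in cobounded ℂ, aeval z P ≠ 0 := by
  have hmap : P.map (Nat.castRingHom ℂ) ≠ 0 :=
    (Polynomial.map_ne_zero_iff Nat.cast_injective).2 hP
  filter_upwards [le_cofinite ℂ (finite_setOfPred_isRoot hmap).compl_mem_cofinite] with z hz h0
  exact hz ((eval_map _ _).trans h0)

theorem eventually_sum_norm_aeval_le {τ : Type*} (A : Finset τ) (P : τ → ℕ[X]) :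
    ∀ᶠ z : ℂ in cobounded ℂ, ∑ t ∈ A, ‖aeval z (P t)‖ ≤ 2 * ‖∑ t ∈ A, aeval z (P t)‖ := by
  filter_upwards [eventually_aeval_norm_le (∑ t ∈ A, P t)] with z hz
  rw [map_sum, map_sum] at hz
  exact (Finset.sum_le_sum fun t _ => norm_aeval_nat_le (P t) z).trans hz

theorem natPolynomial_sum_ne_zero {τ : Type*} {A : Finset τ} {P : τ → ℕ[X]} {t : τ} (ht : t ∈ A)
    (hP : P t ≠ 0) : ∑ t ∈ A, P t ≠ 0 := by
  obtain ⟨n, hn⟩ : ∃ n, (P t).coeff n ≠ 0 := by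
    contrapose! hP
    exact Polynomial.ext hP
  refine fun h0 => hn ?_
  have hsum : ∑ t ∈ A, (P t).coeff n = 0 := by rw [← finsetSum_coeff, h0, coeff_zero]
  exact Finset.sum_eq_zero_iff.1 hsum t ht

end NatPolynomial

namespace Multigraph

variable {G : Multigraph}

theorem isIndep_empty : G.IsIndep ∅ :=
  fun e _ he => Finset.notMem_empty _ (he _ e.out_fst_mem)

theorem IsIndep.mono {I J : Finset G.V} (h : G.IsIndep I) (hJ : J ⊆ I) : G.IsIndep J :=
  fun e he hall => h e he fun v hv => hJ (hall v hv)

theorem IsSingleton.subsingleton (h : G.IsSingleton) : Subsingleton G.V :=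
  Fintype.card_le_one_iff_subsingleton.1 h.1.le

theorem IsSingleton.isIndep (h : G.IsSingleton) (I : Finset G.V) : G.IsIndep I := by
  simp [IsIndep, h.2]

end Multigraph

namespace GluingData

open Classical Polynomial Filter Bornology Function

variable {k : ℕ} (D : GluingData k)

theorem label_edgeAt (w : D.W) (j : Fin k) : D.label (D.edgeAt w j) = j :=
  (D.existsUnique_edge w j).choose_spec.1.2

theorem edgeAt_label {e : D.E} {w : D.W} (hw : w ∈ D.verts e) : D.edgeAt w (D.label e) = e :=
  ((D.existsUnique_edge w (D.label e)).choose_spec.2 e ⟨hw, rfl⟩).symm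

/-- The edge `e` is in the image of `Φ`, so that the root of `Σ_e` is marked in `R(G)`. -/
def IsRooted (e : D.E) : Prop := ∃ j, D.Phi j = e

/-- A choice of a set of vertices in every connecting graph: the part of an independent set of
`R(G)` outside the unmarked vertices of the copies of `G`. -/
abbrev Conf : Type := ∀ e : D.E, Finset (D.conn e).V

/-- The number of vertices of `t` that are not marked in `R(G)`. -/
noncomputable def numUnrooted (e : D.E) (t : Finset (D.conn e).V) : ℕ :=
  (t.filter fun v => ¬ (D.IsRooted e ∧ v = D.root e)).card

/-- `s` and `t` agree on the vertices of `Σ_e` that are marked in `R(G)`. -/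
def Match (e : D.E) (s t : Finset (D.conn e).V) : Prop :=
  D.IsRooted e → (D.root e ∈ s ↔ D.root e ∈ t)

/-- The values that `t` induces on the marked vertices of the copy `G(w)`. -/
noncomputable def boundary (w : D.W) (t : D.Conf) : Fin k → Bool := fun j =>
  decide (D.attach (D.edgeAt w j) ⟨w, D.mem_verts_edgeAt w j⟩ ∈ t (D.edgeAt w j))

theorem boundary_label (t : D.Conf) {e : D.E} {w : D.W} (hw : w ∈ D.verts e) :
    D.boundary w t (D.label e) = decide (D.attach e ⟨w, hw⟩ ∈ t e) := by
  unfold boundary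
  generalize_proofs p
  revert p
  rw [D.edgeAt_label hw]
  exact fun _ => rfl

theorem boundary_update_of_mem (t : D.Conf) {e : D.E} {w : D.W} (hw : w ∈ D.verts e)
    (u : Finset (D.conn e).V) :
    D.boundary w (update t e u) =
      update (D.boundary w t) (D.label e) (decide (D.attach e ⟨w, hw⟩ ∈ u)) := by
  funext j
  by_cases hj : j = D.label e
  · subst hj
    rw [D.boundary_label _ hw, update_self, update_self]
  · have hne : D.edgeAt w j ≠ e := fun h => hj (by rw [← h, D.label_edgeAt])
    rw [update_of_ne hj, boundary, update_of_ne hne, boundary]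

theorem boundary_update_of_notMem (t : D.Conf) {e : D.E} {w : D.W} (hw : w ∉ D.verts e)
    (u : Finset (D.conn e).V) : D.boundary w (update t e u) = D.boundary w t := by
  funext j
  have hne : D.edgeAt w j ≠ e := fun h => hw (h ▸ D.mem_verts_edgeAt w j)
  rw [boundary, update_of_ne hne, boundary]

/-- The set of vertices of `Σ_e` that gives the root the value `x` and all other vertices the value
`0`. -/
noncomputable def rootSet (e : D.E) (x : Bool) : Finset (D.conn e).V :=
  if x then {D.root e} else ∅

theorem root_mem_rootSet {e : D.E} {x : Bool} : D.root e ∈ D.rootSet e x ↔ x = true := by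
  cases x <;> simp [rootSet]

/-- The contribution of the choice `t` in `Σ_e`, when every marked vertex labeled `j` that is glued
to `Σ_e` and has the value `x` carries the weight `c j x`. -/
noncomputable def weight (c : Fin k → Bool → ℕ[X]) (e : D.E) (t : Finset (D.conn e).V) : ℕ[X] :=
  if (D.conn e).IsIndep t then
    X ^ D.numUnrooted e t * ∏ w : {w // w ∈ D.verts e}, c (D.label e) (decide (D.attach e w ∈ t))
  else 0

/-- The total weight of the choices in `Σ_e` with the same marked values as `s`. -/
noncomputable def normPoly (c : Fin k → Bool → ℕ[X]) (e : D.E) (s : Finset (D.conn e).V) : ℕ[X] :=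
  ∑ t with D.Match e s t, D.weight c e t

/-- The recursion sends the product state with factors `c` to the product state with these
factors, up to a constant. -/
noncomputable def refStep (c : Fin k → Bool → ℕ[X]) (j : Fin k) (x : Bool) : ℕ[X] :=
  D.normPoly c (D.Phi j) (D.rootSet (D.Phi j) x)

/-- The factors of the reference state after `n` steps: the reference state is a product state,
and the partition functions of `G_n` are close to multiples of it near infinity. -/
noncomputable def refSeq : ℕ → Fin k → Bool → ℕ[X]
  | 0 => fun _ _ => 1
  | n + 1 => D.refStep (refSeq n)

section NeZero

variable {D} {c : Fin k → Bool → ℕ[X]}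

theorem weight_empty_ne_zero (hc : ∀ j, c j false ≠ 0) (e : D.E) : D.weight c e ∅ ≠ 0 := by
  simp [weight, Multigraph.isIndep_empty, hc, X_ne_zero]

theorem normPoly_ne_zero (hc : ∀ j, c j false ≠ 0) {e : D.E} {s : Finset (D.conn e).V}
    (hs : D.Match e s ∅) : D.normPoly c e s ≠ 0 :=
  natPolynomial_sum_ne_zero (Finset.mem_filter.2 ⟨Finset.mem_univ _, hs⟩)
    (weight_empty_ne_zero hc e)

theorem refSeq_false_ne_zero (n : ℕ) (j : Fin k) : D.refSeq n j false ≠ 0 := by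
  induction n generalizing j with
  | zero => exact one_ne_zero
  | succ n ih => exact normPoly_ne_zero ih fun _ => by simp [rootSet]

end NeZero

section Periodic

variable {D} (hstable : D.IsStable) {j : Fin k} (hj : j ∈ periodicPts D.labelMap)

include hstable hj

theorem IsStable.subsingleton : Subsingleton (D.conn (D.Phi j)).V :=
  (hstable.2 j hj).subsingleton

theorem IsStable.card_verts : (D.verts (D.Phi j)).card = 1 :=
  le_antisymm (Nat.lt_succ_iff.1 (not_le.1 (hstable.1 j hj))) (D.verts_nonempty _).card_pos

theorem IsStable.match_iff {s t : Finset (D.conn (D.Phi j)).V} :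
    D.Match (D.Phi j) s t ↔ s = t := by
  have := hstable.subsingleton hj
  refine ⟨fun h => Finset.ext fun v => ?_, fun h _ => h ▸ Iff.rfl⟩
  rw [Subsingleton.elim v (D.root (D.Phi j))]
  exact h ⟨j, rfl⟩

theorem IsStable.weight_eq (c : Fin k → Bool → ℕ[X]) (t : Finset (D.conn (D.Phi j)).V) :
    D.weight c (D.Phi j) t = c (D.labelMap j) (decide (D.root (D.Phi j) ∈ t)) := by
  have := hstable.subsingleton hj
  have hdecide : ∀ v, decide (v ∈ t) = decide (D.root (D.Phi j) ∈ t) := fun v => by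
    rw [Subsingleton.elim v]
  have hcount : D.numUnrooted (D.Phi j) t = 0 :=
    Finset.card_eq_zero.2 <| Finset.filter_eq_empty_iff.2 fun v _ h =>
      h ⟨⟨j, rfl⟩, Subsingleton.elim _ _⟩
  rw [weight, if_pos ((hstable.2 j hj).isIndep t), hcount]
  simp only [hdecide]
  rw [Finset.prod_const, Finset.card_univ, Fintype.card_coe, hstable.card_verts hj, pow_zero,
    one_mul, pow_one, labelMap]

theorem IsStable.normPoly_eq (c : Fin k → Bool → ℕ[X]) (s : Finset (D.conn (D.Phi j)).V) :
    D.normPoly c (D.Phi j) s = D.weight c (D.Phi j) s := by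
  simp only [normPoly, hstable.match_iff hj, Finset.filter_eq, Finset.mem_univ, if_true,
    Finset.sum_singleton]

theorem IsStable.refStep_eq (c : Fin k → Bool → ℕ[X]) : D.refStep c j = c (D.labelMap j) := by
  funext x
  rw [refStep, hstable.normPoly_eq hj, hstable.weight_eq hj]
  simp only [root_mem_rootSet, Bool.decide_eq_true]

theorem IsStable.refSeq_eq_one (n : ℕ) : D.refSeq n j = 1 := by
  induction n generalizing j with
  | zero => rfl
  | succ n ih =>
    exact (hstable.refStep_eq hj _).trans (ih ((bijOn_periodicPts D.labelMap).mapsTo hj))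

end Periodic

theorem refStep_congr {c c' : Fin k → Bool → ℕ[X]} {j : Fin k}
    (h : c (D.labelMap j) = c' (D.labelMap j)) : D.refStep c j = D.refStep c' j := by
  funext x
  unfold refStep normPoly weight
  rw [← labelMap, h]

namespace IsStable

variable {D} (hstable : D.IsStable)

include hstable

theorem refSeq_eq_of_le (r : ℕ) {j : Fin k} (hj : D.labelMap^[r] j ∈ periodicPts D.labelMap)
    {n : ℕ} (hn : r ≤ n) : D.refSeq n j = D.refSeq r j := by
  induction r generalizing j n with
  | zero => rw [hstable.refSeq_eq_one (j := j) hj, hstable.refSeq_eq_one (j := j) hj]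
  | succ r ih =>
    obtain ⟨n, rfl⟩ := Nat.exists_eq_add_of_le' (Nat.one_le_of_lt hn)
    exact D.refStep_congr (ih hj (Nat.le_of_succ_le_succ hn))

theorem finite_range_refSeq : (Set.range D.refSeq).Finite := by
  choose r hr using exists_iterate_mem_periodicPts D.labelMap
  have hle : ∀ j, r j ≤ ∑ j, r j := fun j =>
    Finset.single_le_sum (fun _ _ => Nat.zero_le _) (Finset.mem_univ j)
  refine ((Set.finite_Iic (∑ j, r j)).image D.refSeq).subset ?_
  rintro _ ⟨n, rfl⟩
  rcases le_total n (∑ j, r j) with h | h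
  · exact ⟨n, h, rfl⟩
  · refine ⟨_, Set.mem_Iic.2 le_rfl, funext fun j => ?_⟩
    rw [hstable.refSeq_eq_of_le (r j) (hr j) ((hle j).trans h),
      hstable.refSeq_eq_of_le (r j) (hr j) (hle j)]

theorem eventually_forall_refSeq {p : (Fin k → Bool → ℕ[X]) → ℂ → Prop}
    (h : ∀ n, ∀ᶠ z in cobounded ℂ, p (D.refSeq n) z) :
    ∀ᶠ z in cobounded ℂ, ∀ n, p (D.refSeq n) z := by
  have hrange := (eventually_all_finite hstable.finite_range_refSeq).2 (Set.forall_mem_range.2 h)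
  filter_upwards [hrange] with z hz n using hz _ ⟨n, rfl⟩

end IsStable

/-- The complex kernel on the vertex sets of `Σ_e` that resamples the unmarked vertices according
to the weights `c` at fugacity `z`. If the normalizing factor vanishes, it is the identity. -/
noncomputable def kernel (c : Fin k → Bool → ℕ[X]) (z : ℂ) (e : D.E) :
    Matrix (Finset (D.conn e).V) (Finset (D.conn e).V) ℂ :=
  Matrix.of fun s t => if aeval z (D.normPoly c e s) = 0 then (1 : Matrix _ _ ℂ) s t else
    (if D.Match e s t then aeval z (D.weight c e t) else 0) / aeval z (D.normPoly c e s)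

/-- No cancellation occurs among the weights `c` at `z`. -/
def IsDominated (c : Fin k → Bool → ℕ[X]) (z : ℂ) : Prop :=
  ∀ e (s : Finset (D.conn e).V), (∑ t with D.Match e s t, ‖aeval z (D.weight c e t)‖) ≤
    2 * ‖aeval z (D.normPoly c e s)‖

theorem IsStable.eventually_isDominated {D : GluingData k} (hstable : D.IsStable) :
    ∀ᶠ z in cobounded ℂ, ∀ n, D.IsDominated (D.refSeq n) z := by
  refine hstable.eventually_forall_refSeq fun n => eventually_all.2 fun e =>
    eventually_all.2 fun s => ?_
  filter_upwards [eventually_sum_norm_aeval_le (Finset.univ.filter fun t => D.Match e s t)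
    (fun t => D.weight (D.refSeq n) e t)] with z hz
  rwa [normPoly, map_sum]

section Kernel

variable {D} {c : Fin k → Bool → ℕ[X]} {z : ℂ}

theorem IsDominated.isAveraging_kernel (hz : D.IsDominated c z) (e : D.E) :
    IsAveraging (D.kernel c z e) := by
  refine ⟨fun s => ?_, fun s => ?_⟩ <;> by_cases h : aeval z (D.normPoly c e s) = 0
  · simp only [kernel, Matrix.of_apply, if_pos h]
    exact IsAveraging.one.sum_eq_one s
  · simp only [kernel, Matrix.of_apply, if_neg h]
    rw [← Finset.sum_div, ← Finset.sum_filter, div_eq_one_iff_eq h, normPoly, map_sum]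
  · simp only [kernel, Matrix.of_apply, if_pos h]
    exact IsAveraging.one.sum_norm_le s
  · simp only [kernel, Matrix.of_apply, if_neg h, norm_div]
    rw [← Finset.sum_div, div_le_iff₀ (norm_pos_iff.2 h)]
    simpa only [apply_ite norm, norm_zero, ← Finset.sum_filter] using hz e s

theorem IsDominated.normPoly_mul_kernel (hz : D.IsDominated c z) (e : D.E)
    (s t : Finset (D.conn e).V) : aeval z (D.normPoly c e s) * D.kernel c z e s t =
      if D.Match e s t then aeval z (D.weight c e t) else 0 := by
  by_cases h : aeval z (D.normPoly c e s) = 0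
  · have hvanish : D.Match e s t → aeval z (D.weight c e t) = 0 := fun hm => by
      have hsum := hz e s
      rw [h, norm_zero, mul_zero] at hsum
      have hle := Finset.single_le_sum (f := fun t => ‖aeval z (D.weight c e t)‖)
        (fun _ _ => norm_nonneg _) (Finset.mem_filter.2 ⟨Finset.mem_univ t, hm⟩)
      exact norm_le_zero_iff.1 (hle.trans hsum)
    rw [h, zero_mul]
    exact (ite_eq_right_iff.2 hvanish).symm
  · rw [kernel, Matrix.of_apply, if_neg h, mul_div_cancel₀ _ h]

theorem IsStable.kernel_eq_one (hstable : D.IsStable) {j : Fin k}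
    (hj : j ∈ periodicPts D.labelMap) : D.kernel c z (D.Phi j) = 1 := by
  ext s t
  rw [kernel, Matrix.of_apply]
  split_ifs with h hst
  · rfl
  · obtain rfl := (hstable.match_iff hj).1 hst
    rw [← hstable.normPoly_eq hj, div_self h, Matrix.one_apply_eq]
  · rw [zero_div, Matrix.one_apply_ne fun hst' => hst ((hstable.match_iff hj).2 hst')]

end Kernel

end GluingData

namespace MarkedGraph

open Classical

variable {k : ℕ} (G : MarkedGraph k)

/-- The number of vertices of `I` that are not marked. -/
noncomputable def numUnmarked (I : Finset G.V) : ℕ :=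
  (I.filter fun v => ¬ ∃ j, G.mark j = v).card

/-- The partition function with prescribed values `x` on the marked vertices, in which marked
vertices are not counted. -/
noncomputable def partition (z : ℂ) (x : Fin k → Bool) : ℂ :=
  ∑ I with G.IsIndep I ∧ G.Agrees x I, z ^ G.numUnmarked I

variable {G}

theorem agrees_iff {x : Fin k → Bool} {I : Finset G.V} :
    G.Agrees x I ↔ (fun j => decide (G.mark j ∈ I)) = x := by
  simp only [Agrees, funext_iff]
  refine forall_congr' fun j => ?_
  cases x j <;> simp

theorem Agrees.card_eq {x : Fin k → Bool} {I : Finset G.V} (h : G.Agrees x I) :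
    I.card = (Finset.univ.filter fun j => x j = true).card + G.numUnmarked I := by
  have hmarked : (I.filter fun v => ∃ j, G.mark j = v) =
      (Finset.univ.filter fun j => x j = true).image G.mark := by
    ext v
    simp only [Finset.mem_filter, Finset.mem_image, Finset.mem_univ, true_and]
    constructor
    · rintro ⟨hv, j, rfl⟩
      exact ⟨j, (h j).1 hv, rfl⟩
    · rintro ⟨j, hj, rfl⟩
      exact ⟨(h j).2 hj, j, rfl⟩
  rw [numUnmarked, ← Finset.card_filter_add_card_filter_not (s := I) fun v => ∃ j, G.mark j = v,
    hmarked, Finset.card_image_of_injective _ G.mark_injective]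

theorem eval_indepPoly (z : ℂ) : G.indepPoly.eval z =
    ∑ x, z ^ (Finset.univ.filter fun j => x j = true).card * G.partition z x := by
  unfold Multigraph.indepPoly partition
  rw [Polynomial.eval_finsetSum,
    ← Finset.sum_fiberwise _ fun I j => decide (G.mark j ∈ I)]
  refine Finset.sum_congr rfl fun x _ => ?_
  rw [Finset.mul_sum, Finset.filter_filter]
  simp only [← agrees_iff]
  refine Finset.sum_congr rfl fun I hI => ?_
  rw [Polynomial.eval_pow, Polynomial.eval_X, ← pow_add,
    Agrees.card_eq (Finset.mem_filter.1 hI).2.2]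

end MarkedGraph

namespace GluingData

open Classical Polynomial Function

variable {k : ℕ} (D : GluingData k) (G : MarkedGraph k)

theorem copyMap_mark_eq (w : D.W) (j : Fin k) : D.copyMap G w (G.mark j) =
    Sum.inr ⟨D.edgeAt w j, D.attach _ ⟨w, D.mem_verts_edgeAt w j⟩⟩ := by
  have h := D.copyMap_mark G (D.edgeAt w j) w (D.mem_verts_edgeAt w j)
  rwa [D.label_edgeAt] at h

theorem copyMap_unmarked (w : D.W) {v : G.V} (h : ¬ ∃ j, G.mark j = v) :
    D.copyMap G w v = Sum.inl (w, ⟨v, h⟩) :=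
  dif_neg h

/-- The part of `I` in the connecting graphs. -/
noncomputable def connPart (I : Finset (D.RecVertex G)) : D.Conf := fun e =>
  Finset.univ.filter fun v => (Sum.inr ⟨e, v⟩ : D.RecVertex G) ∈ I

/-- The part of `I` in the copy `G(w)`, including the marked vertices. -/
noncomputable def copyPart (I : Finset (D.RecVertex G)) (w : D.W) : Finset G.V :=
  Finset.univ.filter fun v => D.copyMap G w v ∈ I

/-- The set of vertices of `R(G)` with the part `t` in the connecting graphs and with the part of
`J w` in the unmarked vertices of the copy `G(w)`. -/
noncomputable def assemble (t : D.Conf) (J : D.W → Finset G.V) : Finset (D.RecVertex G) :=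
  Finset.univ.filter fun u => Sum.elim (fun p => p.2.1 ∈ J p.1) (fun q => q.2 ∈ t q.1) u

/-- The vertex sets of the connecting graphs that contain at most the marked roots, as prescribed
by `y`. -/
noncomputable def rootConf (y : Fin k → Bool) : D.Conf := fun e =>
  D.rootSet e (decide (∃ j, D.Phi j = e ∧ y j = true))

variable {D G}

theorem rootConf_Phi (y : Fin k → Bool) (j : Fin k) :
    D.rootConf y (D.Phi j) = D.rootSet (D.Phi j) (y j) := by
  simp [rootConf, D.Phi_injective.eq_iff]

theorem rootConf_of_not_isRooted (y : Fin k → Bool) {e : D.E} (he : ¬ D.IsRooted e) :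
    D.rootConf y e = ∅ := by
  have hne : ∀ j, D.Phi j ≠ e := fun j hj => he ⟨j, hj⟩
  simp [rootConf, rootSet, hne]

theorem rootConf_update (y : Fin k → Bool) (j : Fin k) (x : Bool) :
    D.rootConf (update y j x) = update (D.rootConf y) (D.Phi j) (D.rootSet (D.Phi j) x) := by
  funext e
  by_cases he : D.IsRooted e
  · obtain ⟨l, rfl⟩ := he
    rcases eq_or_ne l j with rfl | hl
    · rw [update_self, rootConf_Phi, update_self]
    · rw [update_of_ne (D.Phi_injective.ne hl), rootConf_Phi, rootConf_Phi, update_of_ne hl]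
  · have hne : e ≠ D.Phi j := fun h => he ⟨j, h.symm⟩
    rw [update_of_ne hne, rootConf_of_not_isRooted _ he, rootConf_of_not_isRooted _ he]

@[simp] theorem mem_connPart {I : Finset (D.RecVertex G)} {e : D.E} {v : (D.conn e).V} :
    v ∈ D.connPart G I e ↔ Sum.inr ⟨e, v⟩ ∈ I := by
  simp [connPart]

@[simp] theorem mem_copyPart {I : Finset (D.RecVertex G)} {w : D.W} {v : G.V} :
    v ∈ D.copyPart G I w ↔ D.copyMap G w v ∈ I := by
  simp [copyPart]

@[simp] theorem inl_mem_assemble {t : D.Conf} {J : D.W → Finset G.V} {w : D.W}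
    {v : {v : G.V // ¬ ∃ j, G.mark j = v}} :
    (Sum.inl (w, v) : D.RecVertex G) ∈ D.assemble G t J ↔ v.1 ∈ J w := by
  simp [assemble]

@[simp] theorem inr_mem_assemble {t : D.Conf} {J : D.W → Finset G.V} {e : D.E}
    {v : (D.conn e).V} : (Sum.inr ⟨e, v⟩ : D.RecVertex G) ∈ D.assemble G t J ↔ v ∈ t e := by
  simp [assemble]

theorem mem_edges_recursion {a : Sym2 (D.RecVertex G)} : a ∈ (D.recursion G).edges ↔
    (∃ w, ∃ b ∈ G.edges, Sym2.map (D.copyMap G w) b = a) ∨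
      ∃ e, ∃ b ∈ (D.conn e).edges, Sym2.map (fun v => (Sum.inr ⟨e, v⟩ : D.RecVertex G)) b = a := by
  refine Multiset.mem_add.trans (or_congr (Multiset.mem_sum.trans ?_) (Multiset.mem_sum.trans ?_))
  all_goals simp only [Finset.mem_univ, true_and, Multiset.mem_map]

theorem recursion_isIndep_iff {I : Finset (D.RecVertex G)} :
    (D.recursion G).IsIndep I ↔
      (∀ w, G.IsIndep (D.copyPart G I w)) ∧ ∀ e, (D.conn e).IsIndep (D.connPart G I e) := by
  have hmap : ∀ {α : Type} (f : α → D.RecVertex G) (a : Sym2 α),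
      (∀ v ∈ Sym2.map f a, v ∈ I) ↔ ∀ v ∈ a, f v ∈ I := fun f a => by
    simp only [Sym2.mem_map, forall_exists_index, and_imp, forall_apply_eq_imp_iff₂]
  simp only [Multigraph.IsIndep, mem_copyPart, mem_connPart]
  refine ⟨fun h => ⟨fun w a ha hI => ?_, fun e a ha hI => ?_⟩, fun ⟨hcopy, hconn⟩ a ha hI => ?_⟩
  · exact h _ (mem_edges_recursion.2 (Or.inl ⟨w, a, ha, rfl⟩)) ((hmap _ a).2 hI)
  · exact h _ (mem_edges_recursion.2 (Or.inr ⟨e, a, ha, rfl⟩)) ((hmap _ a).2 hI)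
  · obtain ⟨w, b, hb, rfl⟩ | ⟨e, b, hb, rfl⟩ := mem_edges_recursion.1 ha
    · exact hcopy w b hb ((hmap _ b).1 hI)
    · exact hconn e b hb ((hmap _ b).1 hI)

theorem recursion_agrees_iff {y : Fin k → Bool} {I : Finset (D.RecVertex G)} :
    (D.recursion G).Agrees y I ↔ ∀ e, D.Match e (D.rootConf y e) (D.connPart G I e) := by
  simp only [Match, IsRooted, forall_exists_index, forall_apply_eq_imp_iff, rootConf_Phi,
    root_mem_rootSet, mem_connPart]
  exact forall_congr' fun j => iff_comm

theorem agrees_boundary_copyPart (I : Finset (D.RecVertex G)) (w : D.W) :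
    G.Agrees (D.boundary w (D.connPart G I)) (D.copyPart G I w) := by
  intro j
  rw [mem_copyPart, D.copyMap_mark_eq, boundary, decide_eq_true_iff, mem_connPart]

theorem exists_recursion_mark_eq_iff {e : D.E} {v : (D.conn e).V} :
    (∃ j, (D.recursion G).mark j = (Sum.inr ⟨e, v⟩ : D.RecVertex G)) ↔
      D.IsRooted e ∧ v = D.root e := by
  constructor
  · rintro ⟨j, hj⟩
    have h := Sum.inr_injective hj
    obtain rfl : D.Phi j = e := congrArg Sigma.fst h
    exact ⟨⟨j, rfl⟩, (eq_of_heq (Sigma.mk.inj h).2).symm⟩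
  · rintro ⟨⟨j, rfl⟩, rfl⟩
    exact ⟨j, rfl⟩

theorem recursion_numUnmarked (I : Finset (D.RecVertex G)) :
    (D.recursion G).numUnmarked I =
      ∑ e, D.numUnrooted e (D.connPart G I e) + ∑ w, G.numUnmarked (D.copyPart G I w) := by
  have hsplit : (D.recursion G).numUnmarked I = ∑ u : D.RecVertex G,
      if u ∈ I ∧ ¬ ∃ j, (D.recursion G).mark j = u then 1 else 0 := by
    rw [← Finset.card_filter, ← Finset.filter_filter, Finset.filter_univ_mem]
    rfl
  rw [hsplit, Fintype.sum_sum_type, Fintype.sum_prod_type, Fintype.sum_sigma, add_comm]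
  congr 1
  · refine Finset.sum_congr rfl fun e _ => ?_
    rw [numUnrooted, ← Finset.card_filter]
    congr 1
    ext v
    simp only [Finset.mem_filter, Finset.mem_univ, true_and, exists_recursion_mark_eq_iff,
      mem_connPart]
  · refine Finset.sum_congr rfl fun w _ => ?_
    have hcopy : G.numUnmarked (D.copyPart G I w) =
        ∑ v with ¬ ∃ j, G.mark j = v, if D.copyMap G w v ∈ I then 1 else 0 := by
      rw [MarkedGraph.numUnmarked, copyPart, ← Finset.card_filter, Finset.filter_comm]
    rw [hcopy, Finset.sum_subtype (p := fun v => ¬ ∃ j, G.mark j = v) _ (by simp)]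
    refine Finset.sum_congr rfl fun v _ => ?_
    rw [D.copyMap_unmarked G w v.2]
    exact if_congr (and_iff_left fun ⟨j, hj⟩ => Sum.inr_ne_inl hj) rfl rfl

theorem connPart_assemble (t : D.Conf) (J : D.W → Finset G.V) :
    D.connPart G (D.assemble G t J) = t := by
  funext e
  ext v
  simp

theorem copyPart_assemble {t : D.Conf} {J : D.W → Finset G.V}
    (h : ∀ w, G.Agrees (D.boundary w t) (J w)) : D.copyPart G (D.assemble G t J) = J := by
  funext w
  ext v
  rw [mem_copyPart]
  by_cases hv : ∃ j, G.mark j = v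
  · obtain ⟨j, rfl⟩ := hv
    rw [D.copyMap_mark_eq, inr_mem_assemble, h w j, boundary, decide_eq_true_iff]
  · rw [D.copyMap_unmarked G w hv, inl_mem_assemble]

theorem assemble_parts (I : Finset (D.RecVertex G)) :
    D.assemble G (D.connPart G I) (D.copyPart G I) = I := by
  ext u
  rcases u with ⟨w, v⟩ | ⟨e, v⟩
  · rw [inl_mem_assemble, mem_copyPart, D.copyMap_unmarked G w v.2]
  · rw [inr_mem_assemble, mem_connPart]

theorem recursion_partition (z : ℂ) (y : Fin k → Bool) :
    (D.recursion G).partition z y = ∑ t : D.Conf,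
      (∏ e, if D.Match e (D.rootConf y e) (t e) ∧ (D.conn e).IsIndep (t e) then
        z ^ D.numUnrooted e (t e) else 0) * ∏ w, G.partition z (D.boundary w t) := by
  simp only [Finset.prod_ite_zero, ite_mul, zero_mul, Finset.mem_univ, true_imp_iff]
  rw [← Finset.sum_filter]
  simp only [MarkedGraph.partition, Finset.prod_univ_sum, Finset.mul_sum]
  rw [Finset.sum_sigma']
  refine Finset.sum_bij' (fun I _ => ⟨D.connPart G I, D.copyPart G I⟩)
    (fun p _ => D.assemble G p.1 p.2) (fun I hI => ?_) ?_ (fun I _ => assemble_parts I) ?_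
    fun I _ => ?_
  · obtain ⟨-, hI, hy⟩ := Finset.mem_filter.1 hI
    obtain ⟨hcopy, hconn⟩ := recursion_isIndep_iff.1 hI
    refine Finset.mem_sigma.2 ⟨Finset.mem_filter.2 ⟨Finset.mem_univ _, fun e =>
      ⟨recursion_agrees_iff.1 hy e, hconn e⟩⟩, Fintype.mem_piFinset.2 fun w =>
        Finset.mem_filter.2 ⟨Finset.mem_univ _, hcopy w, agrees_boundary_copyPart I w⟩⟩
  · rintro ⟨t, J⟩ hp
    obtain ⟨ht, hJ⟩ := Finset.mem_sigma.1 hp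
    have ht := (Finset.mem_filter.1 ht).2
    have hJ := fun w => (Finset.mem_filter.1 (Fintype.mem_piFinset.1 hJ w)).2
    refine Finset.mem_filter.2 ⟨Finset.mem_univ _, ?_, ?_⟩
    · rw [recursion_isIndep_iff, copyPart_assemble fun w => (hJ w).2, connPart_assemble]
      exact ⟨fun w => (hJ w).1, fun e => (ht e).2⟩
    · rw [recursion_agrees_iff, connPart_assemble]
      exact fun e => (ht e).1
  · rintro ⟨t, J⟩ hp
    have hJ := fun w =>
      (Finset.mem_filter.1 (Fintype.mem_piFinset.1 (Finset.mem_sigma.1 hp).2 w)).2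
    simp only [connPart_assemble, copyPart_assemble fun w => (hJ w).2]
  · refine (congrArg (z ^ ·) (recursion_numUnmarked I)).trans ?_
    rw [pow_add, Finset.prod_pow_eq_pow_sum, Finset.prod_pow_eq_pow_sum]

end GluingData

theorem prod_one_add_ite_sub_one_le {W : Type*} [Fintype W] [DecidableEq W] (s : Finset W) {x : ℝ}
    (hx : s.Nonempty → 0 ≤ x ∧ x ≤ 1) :
    ∏ w, (1 + if w ∈ s then x else 0) - 1 ≤ (2 ^ s.card - 1) * x := by
  have hprod : ∏ w, (1 + if w ∈ s then x else 0) = (1 + x) ^ s.card := by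
    simp only [add_ite, add_zero, Finset.prod_ite_mem, Finset.univ_inter, Finset.prod_const]
  rw [hprod]
  rcases s.eq_empty_or_nonempty with rfl | hs
  · simp
  · exact one_add_pow_sub_one_le _ (hx hs).1 (hx hs).2

namespace GluingData

open Classical Polynomial Function Filter

variable {k : ℕ} {D : GluingData k} {c : Fin k → Bool → ℕ[X]} {z : ℂ}

/-- The product state with factors `c`: an approximation, up to a constant, of the partition
function with prescribed values on the marked vertices. -/
noncomputable def refState (c : Fin k → Bool → ℕ[X]) (z : ℂ) (x : Fin k → Bool) : ℂ :=
  ∏ j, aeval z (c j (x j))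

theorem prod_refState_boundary (t : D.Conf) :
    ∏ w, refState c z (D.boundary w t) =
      ∏ e, ∏ w : {w // w ∈ D.verts e}, aeval z (c (D.label e) (decide (D.attach e w ∈ t e))) := by
  simp only [refState]
  rw [← Fintype.prod_prod_type' (f := fun w j => aeval z (c j (D.boundary w t j))),
    ← Fintype.prod_sigma' (f := fun e (w : {w // w ∈ D.verts e}) =>
      aeval z (c (D.label e) (decide (D.attach e w ∈ t e))))]
  refine (Fintype.prod_bijective (fun p => (p.2.1, D.label p.1)) ⟨?_, ?_⟩ _ _ ?_).symm
  · rintro ⟨e, w, hw⟩ ⟨e', w', hw'⟩ h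
    obtain ⟨rfl, hlabel⟩ := Prod.mk.inj h
    obtain rfl : e = e' := by rw [← D.edgeAt_label hw, ← D.edgeAt_label hw', hlabel]
    rfl
  · rintro ⟨w, j⟩
    exact ⟨⟨D.edgeAt w j, w, D.mem_verts_edgeAt w j⟩, Prod.ext rfl (D.label_edgeAt w j)⟩
  · rintro ⟨e, w, hw⟩
    rw [D.boundary_label t hw]

theorem aeval_weight (e : D.E) (t : Finset (D.conn e).V) : aeval z (D.weight c e t) =
    if (D.conn e).IsIndep t then z ^ D.numUnrooted e t *
      ∏ w : {w // w ∈ D.verts e}, aeval z (c (D.label e) (decide (D.attach e w ∈ t))) else 0 := by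
  unfold weight
  split_ifs <;> simp

theorem prod_normPoly_rootConf (y : Fin k → Bool) :
    ∏ e, aeval z (D.normPoly c e (D.rootConf y e)) =
      (∏ e with ¬ D.IsRooted e, aeval z (D.normPoly c e ∅)) * refState (D.refStep c) z y := by
  have hrooted : Finset.univ.filter D.IsRooted = Finset.univ.image D.Phi := by
    ext e
    simp [IsRooted]
  rw [← Finset.prod_filter_not_mul_prod_filter (p := D.IsRooted), hrooted,
    Finset.prod_image D.Phi_injective.injOn]
  congr 1
  · refine Finset.prod_congr rfl fun e he => ?_
    rw [rootConf_of_not_isRooted y (Finset.mem_filter.1 he).2]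
  · exact Finset.prod_congr rfl fun j _ => by rw [rootConf_Phi, refStep]

/-- The action of the recursion on the density of the partition function with respect to the
product state with factors `c`. -/
noncomputable def densityStep (D : GluingData k) (c : Fin k → Bool → ℕ[X]) (z : ℂ)
    (r : (Fin k → Bool) → ℂ) (y : Fin k → Bool) : ℂ :=
  productAverage (D.kernel c z) (fun t => ∏ w, r (D.boundary w t)) (D.rootConf y)

theorem recursion_partition_eq (hz : D.IsDominated c z) {G : MarkedGraph k} {K : ℂ}
    {r : (Fin k → Bool) → ℂ} (hG : ∀ x, G.partition z x = K * refState c z x * r x)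
    (y : Fin k → Bool) : (D.recursion G).partition z y =
      (K ^ Fintype.card D.W * ∏ e with ¬ D.IsRooted e, aeval z (D.normPoly c e ∅)) *
        refState (D.refStep c) z y * D.densityStep c z r y := by
  have hfactor : ∀ (t : D.Conf) (e : D.E),
      (if D.Match e (D.rootConf y e) (t e) ∧ (D.conn e).IsIndep (t e) then
        z ^ D.numUnrooted e (t e) else 0) *
      ∏ w : {w // w ∈ D.verts e}, aeval z (c (D.label e) (decide (D.attach e w ∈ t e))) =
      aeval z (D.normPoly c e (D.rootConf y e)) * D.kernel c z e (D.rootConf y e) (t e) := by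
    intro t e
    rw [hz.normPoly_mul_kernel, aeval_weight, ite_and, ite_mul, zero_mul, ite_mul, zero_mul]
  rw [recursion_partition, mul_assoc (K ^ _), ← prod_normPoly_rootConf, densityStep,
    productAverage, Finset.mul_sum]
  refine Finset.sum_congr rfl fun t _ => ?_
  have hprod := Finset.prod_congr (rfl : (Finset.univ : Finset D.E) = Finset.univ)
    fun e _ => hfactor t e
  rw [Finset.prod_mul_distrib, Finset.prod_mul_distrib, ← prod_refState_boundary] at hprod
  simp only [hG, Finset.prod_mul_distrib, Finset.prod_const, Finset.card_univ]
  linear_combination (K ^ Fintype.card D.W * ∏ w, r (D.boundary w t)) * hprod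

theorem hasInfluence_rootConf {f : D.Conf → ℂ} {a : D.E → ℝ} {b : D.E → D.E → ℝ}
    (h : HasInfluence f a b) :
    HasInfluence (fun y => f (D.rootConf y)) (fun j => a (D.Phi j))
      (fun j l => b (D.Phi j) (D.Phi l)) := by
  simpa only [if_true, and_self] using h.comp (p := fun _ => True)
    (fun j _ x => D.rootSet (D.Phi j) x) (fun y j _ x => rootConf_update y j x)
    (fun _ _ h => absurd trivial h) fun _ _ _ _ hjl => D.Phi_injective hjl

theorem hasInfluence_boundary {r : (Fin k → Bool) → ℂ} {a : Fin k → ℝ} {b : Fin k → Fin k → ℝ}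
    (h : HasInfluence r a b) (w : D.W) :
    HasInfluence (fun t => r (D.boundary w t)) (fun e => if w ∈ D.verts e then a (D.label e) else 0)
      (fun e g => if w ∈ D.verts e ∧ w ∈ D.verts g then b (D.label e) (D.label g) else 0) :=
  h.comp (fun e hw u => decide (D.attach e ⟨w, hw⟩ ∈ u))
    (fun t _ hw u => D.boundary_update_of_mem t hw u)
    (fun t _ hw u => D.boundary_update_of_notMem t hw u)
    fun e g he hg heg => by rw [← D.edgeAt_label he, ← D.edgeAt_label hg, heg]

theorem label_ne_label {e g : D.E} (heg : e ≠ g) (h : (D.verts e ∩ D.verts g).Nonempty) :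
    D.label e ≠ D.label g := by
  obtain ⟨w, hw⟩ := h
  obtain ⟨he, hg⟩ := Finset.mem_inter.1 hw
  exact fun hl => heg (by rw [← D.edgeAt_label he, ← D.edgeAt_label hg, hl])

theorem two_pow_card_sub_one_mul_le (s : Finset D.W) {x : ℝ} (hx : 0 ≤ x) :
    (2 ^ s.card - 1) * x ≤ 2 ^ Fintype.card D.W * x := by
  have h : (2 : ℝ) ^ s.card ≤ 2 ^ Fintype.card D.W :=
    pow_le_pow_right₀ (by norm_num) s.card_le_univ
  exact mul_le_mul_of_nonneg_right (by linarith) hx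

theorem exists_prod_boundary_bound (D : GluingData k) :
    ∃ Q : ℝ, 1 ≤ Q ∧ ∀ (r : (Fin k → Bool) → ℂ) (a : Fin k → ℝ) (b : Fin k → Fin k → ℝ),
      HasInfluence r a b → (∀ j, a j ≤ 1) → (∀ j l, j ≠ l → b j l ≤ 1) →
      HasInfluence (fun t : D.Conf => ∏ w, r (D.boundary w t))
        (fun e => if (D.verts e).card = 1 then a (D.label e) else Q * a (D.label e))
        (fun e g => Q *
          if (D.verts e ∩ D.verts g).Nonempty then b (D.label e) (D.label g) else 0) := by
  refine ⟨2 ^ Fintype.card D.W, one_le_pow₀ (by norm_num), fun r a b h ha hb =>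
    (HasInfluence.prod Finset.univ fun w => hasInfluence_boundary h w).mono (fun e => ?_)
    fun e g heg => ?_⟩
  · have hnonneg := h.influence_nonneg (D.label e)
    have hcard := prod_one_add_ite_sub_one_le (D.verts e) fun _ => ⟨hnonneg, ha (D.label e)⟩
    split_ifs with h1
    · linarith [h1 ▸ hcard]
    · exact hcard.trans (two_pow_card_sub_one_mul_le _ hnonneg)
  · simp only [← Finset.mem_inter]
    split_ifs with hne
    · have hlabel := label_ne_label heg hne
      have hnonneg := h.interaction_nonneg hlabel
      exact (prod_one_add_ite_sub_one_le _ fun _ => ⟨hnonneg, hb _ _ hlabel⟩).trans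
        (two_pow_card_sub_one_mul_le _ hnonneg)
    · simp [Finset.not_nonempty_iff_eq_empty.1 hne]

/-- Two different labels are linked if the edges `Φ(j)` and `Φ(l)` meet. Only along linked pairs
are interactions passed on to first order. -/
def Linked (D : GluingData k) (j l : Fin k) : Prop :=
  j ≠ l ∧ (D.verts (D.Phi j) ∩ D.verts (D.Phi l)).Nonempty

theorem ite_interaction_mem_Icc {r : (Fin k → Bool) → ℂ} {a : Fin k → ℝ} {b : Fin k → Fin k → ℝ}
    {M : ℝ} (hr : HasInfluence r a b) (hM : 0 ≤ M) (hb : ∀ j l, j ≠ l → b j l ≤ M) {e g : D.E}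
    (heg : e ≠ g) :
    (if (D.verts e ∩ D.verts g).Nonempty then b (D.label e) (D.label g) else 0) ∈ Set.Icc 0 M := by
  split_ifs with hne
  · have hlabel := label_ne_label heg hne
    exact ⟨hr.interaction_nonneg hlabel, hb _ _ hlabel⟩
  · exact ⟨le_rfl, hM⟩

theorem exists_productAverage_bound (D : GluingData k) :
    ∃ C : ℝ, 1 ≤ C ∧ ∀ (κ : ∀ e : D.E, Matrix (Finset (D.conn e).V) (Finset (D.conn e).V) ℂ)
      (r : (Fin k → Bool) → ℂ) (a : Fin k → ℝ) (b : Fin k → Fin k → ℝ) (M : ℝ),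
      (∀ e, IsAveraging (κ e)) → HasInfluence r a b → 0 ≤ M → (∀ j l, j ≠ l → b j l ≤ M) →
      (∀ j, C * (a j + M) ≤ 1) →
      HasInfluence (productAverage κ fun t : D.Conf => ∏ w, r (D.boundary w t))
        (fun e => if κ e = 1 ∧ (D.verts e).card = 1 then a (D.label e) + C * M
          else C * (a (D.label e) + M))
        (fun e g => C * ((if (D.verts e ∩ D.verts g).Nonempty then b (D.label e) (D.label g)
          else 0) + M ^ 2)) := by
  obtain ⟨C, hC, hbound⟩ := exists_boundsAverages (𝕜 := ℂ)
    (S := fun e : D.E => Finset (D.conn e).V) Finset.univ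
  obtain ⟨Q, hQ, hprod⟩ := D.exists_prod_boundary_bound
  have hQ2 : C * Q ≤ C * Q ^ 2 :=
    mul_le_mul_of_nonneg_left (le_self_pow₀ hQ two_ne_zero) (by linarith)
  have hCQ : 1 ≤ C * Q := one_le_mul_of_one_le_of_one_le hC hQ
  refine ⟨8 * (C * Q ^ 2), by linarith, fun κ r a b M hκ hr hM hb hsmall => ?_⟩
  have ha := hr.influence_nonneg
  have hinter {e g : D.E} (heg : e ≠ g) := ite_interaction_mem_Icc hr hM hb heg
  have hsum : ∀ j, a j + M ≤ 1 := fun j =>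
    (le_mul_of_one_le_left (add_nonneg (ha j) hM) (by linarith)).trans (hsmall j)
  have hrb := hprod r a b hr (fun j => by linarith [hsum j])
    fun j l hjl => by linarith [hsum j, hb j l hjl, ha j]
  have hscale : ∀ {x}, 0 ≤ x → C * (Q * x) ≤ C * Q ^ 2 * x := fun {x} hx => by
    rw [← mul_assoc]
    exact mul_le_mul_of_nonneg_right hQ2 hx
  have hinfl : ∀ e, C * ((if (D.verts e).card = 1 then a (D.label e) else Q * a (D.label e)) +
      Q * M) ≤ C * Q ^ 2 * (a (D.label e) + M) := by
    intro e
    refine le_trans ?_ (hscale (add_nonneg (ha _) hM))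
    rw [mul_add Q]
    gcongr
    split_ifs
    exacts [le_mul_of_one_le_left (ha _) hQ, le_rfl]
  refine (hbound _ _ _ (Q * M) κ hrb (by positivity)
    (fun e g heg => mul_le_mul_of_nonneg_left (hinter heg).2 (by linarith))
    (fun e => by linarith [hinfl e, hsmall (D.label e)]) hκ (by simp)).mono (fun e => ?_)
    fun e g heg => ?_
  · have hnonneg := hrb.influence_nonneg e
    have hinfl_e := hinfl e
    by_cases h : κ e = 1 ∧ (D.verts e).card = 1
    · simp only [h.1, h.2, if_true, and_self]
      nlinarith [hscale hM]
    · rw [if_neg h]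
      split_ifs at hnonneg hinfl_e ⊢ <;> nlinarith [ha (D.label e)]
  · nlinarith [hscale (hinter heg).1, (hinter heg).1, sq_nonneg M]

theorem exists_densityStep_bound (hstable : D.IsStable) :
    ∃ C : ℝ, 1 ≤ C ∧ ∀ (c : Fin k → Bool → ℕ[X]) (z : ℂ) (r : (Fin k → Bool) → ℂ) (a : Fin k → ℝ)
      (b : Fin k → Fin k → ℝ) (M : ℝ), D.IsDominated c z → HasInfluence r a b → 0 ≤ M →
      (∀ j l, j ≠ l → b j l ≤ M) → (∀ j, C * (a j + M) ≤ 1) →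
      HasInfluence (D.densityStep c z r)
        (fun j => if j ∈ periodicPts D.labelMap then a (D.labelMap j) + C * M
          else C * (a (D.labelMap j) + M))
        (fun j l =>
          C * ((if D.Linked j l then b (D.labelMap j) (D.labelMap l) else 0) + M ^ 2)) := by
  obtain ⟨C, hC, hbound⟩ := D.exists_productAverage_bound
  refine ⟨C, hC, fun c z r a b M hz hr hM hb hsmall => ?_⟩
  refine (hasInfluence_rootConf (hbound _ r a b M hz.isAveraging_kernel hr hM hb hsmall)).mono
    (fun j => ?_) fun j l hjl => ?_
  · have ha := hr.influence_nonneg (D.labelMap j)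
    by_cases hj : j ∈ periodicPts D.labelMap
    · rw [if_pos ⟨hstable.kernel_eq_one hj, hstable.card_verts hj⟩, if_pos hj, labelMap]
    · rw [if_neg hj, ← labelMap]
      split_ifs <;> nlinarith
  · simp only [Linked, ne_eq, hjl, not_false_eq_true, true_and, labelMap, le_refl]

theorem exists_mem_verts_iterateSucc (n : ℕ) {j l : Fin k}
    (h : ∀ i < n + 1, D.Linked (D.labelMap^[i] j) (D.labelMap^[i] l)) :
    ∃ w, w ∈ (D.iterateSucc n).verts ((D.iterateSucc n).Phi j) ∧
      w ∈ (D.iterateSucc n).verts ((D.iterateSucc n).Phi l) := by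
  induction n generalizing j l with
  | zero => exact (h 0 (by omega)).2.imp fun w hw => Finset.mem_inter.1 hw
  | succ n ih =>
    obtain ⟨w, hw⟩ := (h 0 (by omega)).2
    obtain ⟨hj, hl⟩ := Finset.mem_inter.1 hw
    obtain ⟨v, hvj, hvl⟩ := ih (j := D.labelMap j) (l := D.labelMap l)
      fun i hi => h (i + 1) (by omega)
    exact ⟨(w, v), Finset.mem_product.2 ⟨hj, hvj⟩, Finset.mem_product.2 ⟨hl, hvl⟩⟩

theorem IsExpanding.exists_not_linked (hexp : D.IsExpanding) (j l : Fin k) :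
    ∃ i, ¬ D.Linked (D.labelMap^[i] j) (D.labelMap^[i] l) := by
  obtain ⟨n, hn⟩ := hexp
  by_contra! h
  obtain ⟨w, hj, hl⟩ := exists_mem_verts_iterateSucc n fun i _ => h i
  exact Finset.disjoint_left.1 (hn j l (h 0).1) hj hl

theorem exists_one_le_weights (hexp : D.IsExpanding) {L : ℝ} (hL : 1 ≤ L) :
    ∃ (u : Fin k → ℝ) (v : Fin k → Fin k → ℝ) (U : ℝ), 1 ≤ U ∧ (∀ j, 1 ≤ u j ∧ u j ≤ U) ∧
      (∀ j l, 1 ≤ v j l ∧ v j l ≤ U) ∧ (∀ j ∈ periodicPts D.labelMap, u j = 1) ∧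
      (∀ j ∉ periodicPts D.labelMap, L * u (D.labelMap j) ≤ u j) ∧
      ∀ j l, D.Linked j l → L * v (D.labelMap j) (D.labelMap l) ≤ v j l := by
  obtain ⟨u, hu1, hu_periodic, hu⟩ := exists_one_le_weight
    (p := fun j => j ∉ periodicPts D.labelMap)
    (fun j => (exists_iterate_mem_periodicPts D.labelMap j).imp fun _ => not_not_intro) hL
  obtain ⟨v, hv1, -, hv⟩ := exists_one_le_weight
    (p := fun q : Fin k × Fin k => D.Linked q.1 q.2) (T := Prod.map D.labelMap D.labelMap)
    (fun q => (hexp.exists_not_linked q.1 q.2).imp fun i hi => by rwa [Prod.map_iterate]) hL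
  obtain ⟨U, hU1, huU, hvU⟩ := ((eventually_ge_atTop (1 : ℝ)).and
    ((eventually_all.2 fun j => eventually_ge_atTop (u j)).and
      (eventually_all.2 fun q => eventually_ge_atTop (v q)))).exists
  exact ⟨u, fun j l => v (j, l), U, hU1, fun j => ⟨hu1 j, huU j⟩, fun j l => ⟨hv1 _, hvU _⟩,
    fun j hj => hu_periodic j (not_not_intro hj), hu, fun j l => hv (j, l)⟩

theorem IsStable.exists_contraction (hstable : D.IsStable) (hexp : D.IsExpanding) :
    ∃ (u : Fin k → ℝ) (v : Fin k → Fin k → ℝ) (U K δ : ℝ), (∀ j, 1 ≤ u j ∧ u j ≤ U) ∧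
      (∀ j l, 1 ≤ v j l) ∧ 0 ≤ K ∧ 0 < δ ∧
      ∀ (c : Fin k → Bool → ℕ[X]) (z : ℂ) (r : (Fin k → Bool) → ℂ) (α β : ℝ),
        D.IsDominated c z → 0 ≤ α → 0 ≤ β → α + K * β ≤ δ →
        HasInfluence r (fun j => α * u j) (fun j l => β * v j l) →
        HasInfluence (D.densityStep c z r) (fun j => (α + K * β / 2) * u j)
          (fun j l => β / 2 * v j l) := by
  obtain ⟨C, hC, hbound⟩ := exists_densityStep_bound hstable
  obtain ⟨u, v, U, hU1, hu1, hv1, hu_periodic, hu, hv⟩ :=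
    exists_one_le_weights hexp (L := 4 * C) (by linarith)
  refine ⟨u, v, U, 2 * (C * U), 1 / (2 * (C * U * U)), hu1, fun j l => (hv1 j l).1,
    by positivity, by positivity, fun c z r α β hz hα hβ hsmall hr => ?_⟩
  have hCU : 1 ≤ C * U := one_le_mul_of_one_le_of_one_le hC hU1
  rw [le_div_iff₀ (by positivity)] at hsmall
  have hα_small : C * (α * U) ≤ 1 / 2 := by
    have hU_le : C * (α * U) ≤ C * (α * U) * U := le_mul_of_one_le_right (by positivity) hU1
    have hβ_nonneg : 0 ≤ 2 * (C * U) * β * (2 * (C * U * U)) := by positivity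
    linarith
  have hβ_small : C * (β * U ^ 2) ≤ 1 / 4 := by
    have hCU_mul : C * (β * U ^ 2) ≤ C * U * (C * (β * U ^ 2)) :=
      le_mul_of_one_le_left (by positivity) hCU
    have hα_nonneg : 0 ≤ α * (2 * (C * U * U)) := by positivity
    linarith
  refine (hbound c z r _ _ (β * U) hz hr (by positivity)
    (fun j l _ => mul_le_mul_of_nonneg_left (hv1 j l).2 hβ) (fun j => ?_)).mono (fun j => ?_)
    fun j l _ => ?_
  · have hαu : C * (α * u j) ≤ C * (α * U) := by gcongr; exact (hu1 j).2
    have hβU : C * (β * U) ≤ C * (β * U ^ 2) := by gcongr; exact le_self_pow₀ hU1 two_ne_zero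
    linarith
  · have hCβU : C * (β * U) ≤ C * (β * U) * u j := le_mul_of_one_le_right (by positivity) (hu1 j).1
    split_ifs with hj
    · have hmem : D.labelMap j ∈ periodicPts D.labelMap := (bijOn_periodicPts D.labelMap).mapsTo hj
      rw [hu_periodic _ hmem, hu_periodic _ hj]
      linarith
    · have hαu := mul_le_mul_of_nonneg_left (hu j hj) hα
      have hα_nonneg : 0 ≤ α * u j := mul_nonneg hα (by linarith [(hu1 j).1])
      linarith
  · have hβv : β ≤ β * v j l := le_mul_of_one_le_right hβ (hv1 j l).1
    have hquad := mul_le_mul_of_nonneg_right hβ_small hβ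
    split_ifs with hjl
    · have hlinked := mul_le_mul_of_nonneg_left (hv j l hjl) hβ
      linarith
    · linarith

end GluingData

namespace MarkedGraph

open Filter Bornology

variable {k : ℕ} {G : MarkedGraph k} {x y : Fin k → Bool} {I J : Finset G.V}

theorem IsMaxAgreeing.numUnmarked_le (hI : G.IsMaxAgreeing x I) (hJ : G.IsIndep J)
    (hx : G.Agrees x J) : G.numUnmarked J ≤ G.numUnmarked I := by
  have hcard := hI.2.2 J hJ hx
  rwa [hx.card_eq, hI.2.1.card_eq, add_le_add_iff_left] at hcard

theorem IsMaxAgreeing.numUnmarked_anti (hI : G.IsMaxAgreeing x I) (hJ : G.IsMaxAgreeing y J)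
    (hyx : ∀ j, y j = true → x j = true) : G.numUnmarked I ≤ G.numUnmarked J := by
  classical
  set I' := I.filter fun v => ∀ j, G.mark j = v → y j = true with hI'
  have hnum : G.numUnmarked I' = G.numUnmarked I := by
    unfold numUnmarked
    rw [hI', Finset.filter_filter]
    congr 1
    exact Finset.filter_congr fun v _ =>
      and_iff_right_of_imp fun hv j hj => absurd ⟨j, hj⟩ hv
  have hagrees : G.Agrees y I' := fun j => by
    rw [hI', Finset.mem_filter, hI.2.1 j]
    exact ⟨fun h => h.2 j rfl,
      fun h => ⟨hyx j h, fun l hl => by rwa [G.mark_injective hl]⟩⟩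
  exact hnum ▸ hJ.numUnmarked_le (hI.1.mono (Finset.filter_subset _ _)) hagrees

theorem IsMaximallyIndependent.exists_numUnmarked (h : G.IsMaximallyIndependent) :
    ∃ d : ℕ, ∀ x, ∃ I, G.IsIndep I ∧ G.Agrees x I ∧ G.numUnmarked I = d ∧
      ∀ J, G.IsIndep J → G.Agrees x J → J ≠ I → G.numUnmarked J < d := by
  obtain ⟨I, hI, hcard⟩ := h
  have hends : G.numUnmarked (I fun _ => true) = G.numUnmarked (I fun _ => false) := by
    rw [(hI fun _ => true).1.2.1.card_eq, (hI fun _ => false).1.2.1.card_eq] at hcard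
    simp only [Finset.filter_true, Bool.false_eq_true, Finset.filter_false, Finset.card_univ,
      Fintype.card_fin, Finset.card_empty] at hcard
    omega
  have hconst : ∀ x, G.numUnmarked (I x) = G.numUnmarked (I fun _ => false) := fun x =>
    le_antisymm ((hI x).1.numUnmarked_anti (hI _).1 (by simp))
      (hends ▸ (hI fun _ => true).1.numUnmarked_anti (hI x).1 fun _ _ => rfl)
  refine ⟨_, fun x => ⟨I x, (hI x).1.1, (hI x).1.2.1, hconst x, fun J hJ hx hne => ?_⟩⟩
  rw [← hconst x]
  refine ((hI x).1.numUnmarked_le hJ hx).lt_of_ne fun heq => hne ?_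
  refine (hI x).2 J ⟨hJ, hx, fun J' hJ' hx' => ?_⟩
  rw [hx'.card_eq, hx.card_eq, heq]
  exact Nat.add_le_add_left ((hI x).1.numUnmarked_le hJ' hx') _

theorem IsMaximallyIndependent.exists_eventually_norm_partition_div_sub_one_le
    (h : G.IsMaximallyIndependent) :
    ∃ d : ℕ, ∀ η > 0, ∀ᶠ z in cobounded ℂ, ∀ x, ‖G.partition z x / z ^ d - 1‖ ≤ η := by
  classical
  obtain ⟨d, hd⟩ := h.exists_numUnmarked
  refine ⟨d, fun η hη => eventually_all.2 fun x => ?_⟩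
  obtain ⟨I, hI, hx, rfl, hlt⟩ := hd x
  refine eventually_norm_sum_pow_div_sub_one_le (Finset.mem_filter.2 ⟨Finset.mem_univ _, hI, hx⟩)
    (fun J hJ hne => ?_) hη
  obtain ⟨-, hJ, hJx⟩ := Finset.mem_filter.1 hJ
  exact hlt J hJ hJx hne

end MarkedGraph

namespace GluingData

open Classical Polynomial Filter Bornology Function

variable {k : ℕ} {D : GluingData k}

/-- The contribution of the boundary values `x` to the independence polynomial of the product state
with factors `c`, in which marked vertices are counted. -/
noncomputable def fullWeight (c : Fin k → Bool → ℕ[X]) (x : Fin k → Bool) : ℕ[X] :=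
  X ^ (Finset.univ.filter fun j => x j = true).card * ∏ j, c j (x j)

theorem aeval_fullWeight (c : Fin k → Bool → ℕ[X]) (z : ℂ) (x : Fin k → Bool) :
    aeval z (fullWeight c x) =
      z ^ (Finset.univ.filter fun j => x j = true).card * refState c z x := by
  rw [fullWeight, refState, map_mul, map_pow, aeval_X, map_prod]

namespace IsStable

variable (hstable : D.IsStable)

include hstable

theorem eventually_sum_norm_fullWeight_le : ∀ᶠ z in cobounded ℂ, ∀ n,
    ∑ x, ‖aeval z (fullWeight (D.refSeq n) x)‖ ≤
      2 * ‖∑ x, aeval z (fullWeight (D.refSeq n) x)‖ :=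
  hstable.eventually_forall_refSeq (p := fun c z => ∑ x, ‖aeval z (fullWeight c x)‖ ≤
    2 * ‖∑ x, aeval z (fullWeight c x)‖) fun _ => eventually_sum_norm_aeval_le _ _

theorem eventually_sum_fullWeight_ne_zero : ∀ᶠ z in cobounded ℂ, ∀ n,
    ∑ x, aeval z (fullWeight (D.refSeq n) x) ≠ 0 := by
  refine hstable.eventually_forall_refSeq (p := fun c z => ∑ x, aeval z (fullWeight c x) ≠ 0)
    fun n => ?_
  have hne : fullWeight (D.refSeq n) (fun _ => false) ≠ 0 :=
    mul_ne_zero (pow_ne_zero _ X_ne_zero)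
      (Finset.prod_ne_zero_iff.2 fun j _ => D.refSeq_false_ne_zero n j)
  simpa only [map_sum] using
    eventually_aeval_ne_zero (natPolynomial_sum_ne_zero (Finset.mem_univ _) hne)

theorem eventually_prod_normPoly_ne_zero : ∀ᶠ z in cobounded ℂ, ∀ n,
    ∏ e with ¬ D.IsRooted e, aeval z (D.normPoly (D.refSeq n) e ∅) ≠ 0 := by
  refine hstable.eventually_forall_refSeq (p := fun c z =>
    ∏ e with ¬ D.IsRooted e, aeval z (D.normPoly c e ∅) ≠ 0) fun n => ?_
  simp only [Finset.prod_ne_zero_iff]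
  refine (eventually_all_finset _).2 fun e he => eventually_aeval_ne_zero
    (D.normPoly_ne_zero (D.refSeq_false_ne_zero n) fun h => absurd h (Finset.mem_filter.1 he).2)

end IsStable

/-- `p` is a nonzero multiple of the product state with factors `c` times a density with influences
`a` and interactions `b`. -/
def IsNearRefState (c : Fin k → Bool → ℕ[X]) (z : ℂ) (p : (Fin k → Bool) → ℂ) (a : Fin k → ℝ)
    (b : Fin k → Fin k → ℝ) : Prop :=
  ∃ (K : ℂ) (r : (Fin k → Bool) → ℂ), K ≠ 0 ∧ HasInfluence r a b ∧
    ∀ x, p x = K * refState c z x * r x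

section IsNearRefState

variable {c : Fin k → Bool → ℕ[X]} {z : ℂ} {p : (Fin k → Bool) → ℂ} {a a' : Fin k → ℝ}
  {b b' : Fin k → Fin k → ℝ}

theorem IsNearRefState.mono (h : IsNearRefState c z p a b) (ha : ∀ j, a j ≤ a' j)
    (hb : ∀ j l, j ≠ l → b j l ≤ b' j l) : IsNearRefState c z p a' b' := by
  obtain ⟨K, r, hK, hr, hp⟩ := h
  exact ⟨K, r, hK, hr.mono ha hb, hp⟩

theorem isNearRefState_refSeq_zero {q : ℂ} {η : ℝ} (hq : q ≠ 0) (hη : η ≤ 1 / 4)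
    (h : ∀ x, ‖p x / q - 1‖ ≤ η) :
    IsNearRefState (D.refSeq 0) z p (fun _ => 12 * η) (fun _ _ => 12 * η) := by
  refine ⟨q, fun x => p x / q, hq, .of_norm_sub_one_le hη h, fun x => ?_⟩
  simp only [refState, refSeq, map_one, Finset.prod_const_one, mul_one]
  rw [mul_div_cancel₀ _ hq]

theorem IsNearRefState.recursion {G : MarkedGraph k} (h : IsNearRefState c z (G.partition z) a b)
    (hz : D.IsDominated c z) (hne : ∏ e with ¬ D.IsRooted e, aeval z (D.normPoly c e ∅) ≠ 0)
    (hstep : ∀ r, HasInfluence r a b → HasInfluence (D.densityStep c z r) a' b') :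
    IsNearRefState (D.refStep c) z ((D.recursion G).partition z) a' b' := by
  obtain ⟨K, r, hK, hr, hp⟩ := h
  exact ⟨_, _, mul_ne_zero (pow_ne_zero _ hK) hne, hstep r hr, recursion_partition_eq hz hp⟩

theorem IsNearRefState.sum_ne_zero (h : IsNearRefState c z p a b) {ε : ℝ} (ha : ∀ j, a j ≤ ε)
    (hε : (1 + ε) ^ k - 1 ≤ 1 / 4) (hne : ∑ x, aeval z (fullWeight c x) ≠ 0)
    (hdom : ∑ x, ‖aeval z (fullWeight c x)‖ ≤ 2 * ‖∑ x, aeval z (fullWeight c x)‖) :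
    ∑ x, z ^ (Finset.univ.filter fun j => x j = true).card * p x ≠ 0 := by
  obtain ⟨K, r, hK, hr, hp⟩ := h
  set x₀ : Fin k → Bool := fun _ => false
  have hprod : ∏ j, (1 + a j) ≤ (1 + ε) ^ k := by
    rw [← Fin.prod_const]
    exact Finset.prod_le_prod (fun j _ => by linarith [hr.influence_nonneg j])
      fun j _ => by linarith [ha j]
  have hratio : ∀ x, ‖r x / r x₀ - 1‖ ≤ 1 / 4 := fun x =>
    (hr.norm_div_sub_one_le Finset.univ (by simp)).trans (by linarith)
  have hfactor : ∀ x, z ^ (Finset.univ.filter fun j => x j = true).card * p x =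
      K * r x₀ * (aeval z (fullWeight c x) * (r x / r x₀)) := fun x => by
    rw [hp, aeval_fullWeight]
    field_simp [hr.ne_zero x₀]
  simp only [hfactor]
  rw [← Finset.mul_sum]
  exact mul_ne_zero (mul_ne_zero hK (hr.ne_zero x₀)) (sum_mul_ne_zero hne hdom hratio)

end IsNearRefState

theorem eventually_forall_isNearRefState (hstable : D.IsStable) (hexp : D.IsExpanding)
    {G : MarkedGraph k} (hG : G.IsMaximallyIndependent) {ε : ℝ} (hε : 0 < ε) :
    ∀ᶠ z in cobounded ℂ, ∀ n, ∃ a b, (∀ j, a j ≤ ε) ∧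
      IsNearRefState (D.refSeq n) z ((D.graphSeq G n).partition z) a b := by
  obtain ⟨u, v, U, K, δ, hu, hv, hK, hδ, hstep⟩ := hstable.exists_contraction hexp
  obtain ⟨d, hd⟩ := hG.exists_eventually_norm_partition_div_sub_one_le
  set γ : ℝ := min δ (ε / (|U| + 1))
  have : 0 < γ := by positivity
  set η : ℝ := min (1 / 4) (γ / (12 * (1 + K)))
  have hη_pos : 0 < η := by positivity
  have hη_le : η * (12 * (1 + K)) ≤ γ := (le_div_iff₀ (by positivity)).1 (min_le_right _ _)
  filter_upwards [hd η hη_pos, eventually_ne_cobounded 0, hstable.eventually_isDominated,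
    hstable.eventually_prod_normPoly_ne_zero] with z hz hz0 hdom hne
  -- One step turns `(α, β)` into `(α + K * β / 2, β / 2)`, which preserves `α + K * β`.
  have hinvariant : ∀ n, ∃ α β : ℝ, 0 ≤ α ∧ 0 ≤ β ∧ α + K * β ≤ γ ∧
      IsNearRefState (D.refSeq n) z ((D.graphSeq G n).partition z) (fun j => α * u j)
        (fun j l => β * v j l) := by
    intro n
    induction n with
    | zero =>
      refine ⟨12 * η, 12 * η, by positivity, by positivity, by linarith, ?_⟩
      exact (isNearRefState_refSeq_zero (pow_ne_zero d hz0) (min_le_left _ _) hz).mono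
        (fun j => le_mul_of_one_le_right (by positivity) (hu j).1)
        fun j l _ => le_mul_of_one_le_right (by positivity) (hv j l)
    | succ n ih =>
      obtain ⟨α, β, hα, hβ, hle, hnear⟩ := ih
      exact ⟨α + K * β / 2, β / 2, by positivity, by positivity, by linarith,
        hnear.recursion (hdom n) (hne n) fun r =>
          hstep _ z r α β (hdom n) hα hβ (hle.trans (min_le_left _ _))⟩
  intro n
  obtain ⟨α, β, hα, hβ, hle, hnear⟩ := hinvariant n
  refine ⟨_, _, fun j => ?_, hnear⟩
  have hαγ : α ≤ ε / (|U| + 1) := by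
    linarith [mul_nonneg hK hβ, min_le_right δ (ε / (|U| + 1))]
  calc α * u j ≤ α * (|U| + 1) := by gcongr; linarith [(hu j).2, le_abs_self U]
    _ ≤ ε := (le_div_iff₀ (by positivity)).1 hαγ

theorem eventually_eval_indepPoly_ne_zero (hstable : D.IsStable) (hexp : D.IsExpanding)
    {G : MarkedGraph k} (hG : G.IsMaximallyIndependent) :
    ∀ᶠ z in cobounded ℂ, ∀ n, (D.graphSeq G n).indepPoly.eval z ≠ 0 := by
  set ε : ℝ := 1 / (4 * 2 ^ k) with hε_def
  have hε_mul : 2 ^ k * ε = 1 / 4 := by rw [hε_def]; field_simp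
  have hε_pos : 0 < ε := by positivity
  have hε_one : ε ≤ 1 := by nlinarith [one_le_pow₀ (M₀ := ℝ) (n := k) one_le_two]
  filter_upwards [eventually_forall_isNearRefState hstable hexp hG hε_pos,
    hstable.eventually_sum_fullWeight_ne_zero, hstable.eventually_sum_norm_fullWeight_le]
    with z hz hne hdom n
  obtain ⟨a, b, ha, hnear⟩ := hz n
  rw [MarkedGraph.eval_indepPoly]
  exact hnear.sum_ne_zero ha (by linarith [one_add_pow_sub_one_le k hε_pos.le hε_one]) (hne n)
    (hdom n)

end GluingData

theorem mainTheorem1 (k : ℕ) (hk : 2 ≤ k) (D : GluingData k) (hm : 2 ≤ Fintype.card D.W)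
    (hstable : D.IsStable) (hexp : D.IsExpanding)
    (G₀ : MarkedGraph k) (hG₀ : G₀.IsMaximallyIndependent) :
    ∃ C : ℝ, ∀ (n : ℕ) (z : ℂ), (D.graphSeq G₀ n).indepPoly.IsRoot z → ‖z‖ ≤ C := by
  obtain ⟨C, -, hC⟩ := (Filter.hasBasis_cobounded_norm (E := ℂ)).eventually_iff.1
    (GluingData.eventually_eval_indepPoly_ne_zero hstable hexp hG₀)
  refine ⟨C, fun n z hz => ?_⟩
  by_contra! h
  exact hC h.le n hz
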